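/- Let $K$ be a field of characteristic $0$ and let $q\in K^\times$ be not a root of unity, with a fixed square root $q^{1/2}\in K$ (for example $K=\mathbb{Q}(q^{1/2})$ with $q^{1/2}$ an indeterminate, or $K=\mathbb{C}$). Let $Q$ be a formal variable. For a partition $\lambda$ with conjugate $\lambda^\vee$ and length $\ell(\lambda)$, and for $n\ge 1$, put $$p_n(q^\lambda q^\rho):=\sum_{i=1}^{\ell(\lambda)}(q^{n\lambda_i}-1)q^{n(\frac12-i)}+\frac1{q^{n/2}-q^{-n/2}},\qquad p_n(q^{-\rho}):=-\frac1{q^{n/2}-q^{-n/2}},$$ $$p_n(Qq^\lambda q^\rho,q^{-\rho}):=Q^n\,p_n(q^\lambda q^\rho)+p_n(q^{-\rho}).$$ Let $s_\lambda(\cdot)$ denote the Schur function, regarded as a polynomial in the power sums $p_1,p_2,\dots$ and evaluated at the indicated values of the $p_n$ (with $q^\rho$ meaning $q^\emptyset q^\rho$). Define the formal power series in $Q$ $$Z_{\lambda,\mu}(Q;q,q):=\sum_\eta s_\lambda(q^\eta q^\rho)\,s_\mu(q^\eta q^\rho)\prod_{(i,j)\in\eta}\frac{Q}{(1-q^{h_\eta(i,j)})(1-q^{-h_\eta(i,j)})},\qquad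 h_\eta(i,j)=\eta_i-j+\eta^\vee_j-i+1,$$ summed over all partitions $\eta$, and $f(\lambda):=\prod_{(i,j)\in\lambda}(-1)\,q^{\lambda_i-\lambda_j^\vee+i-j}$. Write $\bullet$ for the empty partition. Then, for all partitions $\lambda,\mu$, the series $Z_{\bullet,\bullet}(Q;q,q)$ has constant term $1$ (so it is invertible) and $$\frac{Z_{\lambda,\mu}(Q;q,q)}{Z_{\bullet,\bullet}(Q;q,q)}=f(\lambda)\,f(\mu)\,s_\lambda(Qq^\rho,q^{-\rho})\,s_\mu(Qq^\lambda q^\rho,q^{-\rho}).$$ The right-hand side is a polynomial in $Q$ of degree at most $|\lambda|+|\mu|$, and of degree exactly $|\lambda|+|\mu|$ if $q$ is transcendental over $\mathbb{Q}$ (in particular if $q$ is an indeterminate). -/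

import Mathlib

/-!
Conventions.  A partition is a `YoungDiagram`; `lam.rowLen i` is the part with (zero-based) index
`i`, `lam.colLen j` is the corresponding part of the conjugate partition, `lam.colLen 0` is the
length and `lam.card` is the weight.  A cell `c` of `lam` is `(c.1, c.2)`, zero-based, so the
usual one-based row and column indices are `c.1 + 1` and `c.2 + 1`.
-/

noncomputable section

section SchurFunctions

variable {A : Type*} [CommRing A] [Algebra ℚ A]

/-- The complete homogeneous symmetric functions `h_n` as polynomials in the power sums
`p 1, p 2, …` (the value `p 0` is never used): `h_0 = 1` and
`n h_n = p_1 h_{n-1} + p_2 h_{n-2} + ⋯ + p_n h_0`,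
i.e. `∑ h_n w^n = exp (∑_{n ≥ 1} p_n w^n / n)`. -/
def completeHomogeneous (p : ℕ → A) : ℕ → A
  | 0 => 1
  | n + 1 => (1 / ((n : ℚ) + 1)) •
      ∑ k : Fin (n + 1), p (k.1 + 1) * completeHomogeneous p (n - k.1)
  decreasing_by omega

/-- `h_{a - b}` for natural numbers `a, b`, with `h_m = 0` for `m < 0`. -/
def completeHomogeneousSub (p : ℕ → A) (a b : ℕ) : A :=
  if b ≤ a then completeHomogeneous p (a - b) else 0

/-- The Schur function `s_lam` as a polynomial in the power sums `p 1, p 2, …`, evaluated at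
elements `p n` of a commutative `ℚ`-algebra: `det (h_{lam_i - i + j})`, `1 ≤ i, j ≤ ℓ(lam)`.
The theorem `schurFunction_mul_alternant` below identifies it, in any finite number
`N ≥ ℓ(lam)` of variables, with the Schur polynomial. -/
def schurFunction (p : ℕ → A) (lam : YoungDiagram) : A :=
  (Matrix.of fun i j : Fin (lam.colLen 0) =>
    completeHomogeneousSub p (lam.rowLen i + j) i).det

/-- The generating function of the `h_n` in finitely many variables. -/
theorem completeHomogeneous_mk_mul_prod {N : ℕ} (x : Fin N → A) :
    PowerSeries.mk (completeHomogeneous fun n => ∑ i, x i ^ n) *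
      ∏ i, (1 - PowerSeries.C (x i) * PowerSeries.X) = 1 := by
  set p : ℕ → A := fun n => ∑ i, x i ^ n with hp
  set H : PowerSeries A := PowerSeries.mk (completeHomogeneous p) with hH
  set G : PowerSeries A := PowerSeries.mk (fun n => p (n + 1)) with hG
  have hH' : PowerSeries.derivative A H = G * H := by
    ext n
    have hn : ((1 / ((n : ℚ) + 1)) • ((n : A) + 1)) = 1 := by
      have h0 : ((n : ℚ) + 1) ≠ 0 := by positivity
      have h1 : ((n : A) + 1) = algebraMap ℚ A ((n : ℚ) + 1) := by simp
      rw [h1, Algebra.smul_def, ← map_mul, one_div, inv_mul_cancel₀ h0, map_one]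
    rw [PowerSeries.coeff_derivative, PowerSeries.coeff_mul, hH, PowerSeries.coeff_mk,
      completeHomogeneous, smul_mul_assoc, mul_comm, ← smul_mul_assoc, hn, one_mul,
      Finset.Nat.sum_antidiagonal_eq_sum_range_succ_mk, Finset.sum_range]
    simp [hG]
  have hE' : PowerSeries.derivative A (∏ i, (1 - PowerSeries.C (x i) * PowerSeries.X)) =
      -G * ∏ i, (1 - PowerSeries.C (x i) * PowerSeries.X) := by
    have hGs : G = ∑ i, PowerSeries.mk (fun n => x i ^ (n + 1)) := by
      ext n
      simp [hG, hp]
    rw [hGs]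
    generalize (Finset.univ : Finset (Fin N)) = s
    induction s using Finset.induction_on with
    | empty => simp
    | insert a s ha ih =>
      have h1 : PowerSeries.mk (fun n => x a ^ (n + 1)) *
          (1 - PowerSeries.C (x a) * PowerSeries.X) = PowerSeries.C (x a) := by
        ext n
        rw [mul_sub, mul_one, ← mul_assoc, map_sub]
        cases n with
        | zero => simp
        | succ n =>
          rw [PowerSeries.coeff_succ_mul_X, mul_comm, PowerSeries.coeff_C_mul]
          simp
          ring
      have h2 : PowerSeries.derivative A (1 - PowerSeries.C (x a) * PowerSeries.X) =
          -PowerSeries.C (x a) := by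
        simp [Derivation.leibniz]
      rw [Finset.prod_insert ha, Finset.sum_insert ha, Derivation.leibniz, ih, h2]
      simp only [smul_eq_mul]
      linear_combination
        (∏ i ∈ s, (1 - PowerSeries.C (x i) * PowerSeries.X)) * h1
  have : IsAddTorsionFree A := IsAddTorsionFree.of_module_rat A
  apply PowerSeries.derivative.ext
  · rw [Derivation.leibniz, hH', hE']
    simp only [smul_eq_mul, Derivation.map_one_eq_zero]
    ring
  · simp [hH, map_prod, completeHomogeneous]

/-- In `N ≥ ℓ(lam)` variables `x_1, …, x_N` (that is, at `p_n = x_1^n + ⋯ + x_N^n`) the Schur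
function is the quotient of alternants
`det (x_k^{lam_i + N - i}) / det (x_k^{N - i})`. -/
theorem schurFunction_mul_alternant (lam : YoungDiagram) {N : ℕ} (hN : lam.colLen 0 ≤ N)
    (x : Fin N → A) :
    schurFunction (fun n => ∑ i, x i ^ n) lam *
        (Matrix.of fun i k : Fin N => x k ^ (N - 1 - i)).det =
      (Matrix.of fun i k : Fin N => x k ^ (lam.rowLen i + (N - 1 - i))).det := by
  set p : ℕ → A := fun n => ∑ i, x i ^ n with hp
  have hJT : ∀ m, lam.colLen 0 ≤ m → (Matrix.of fun i j : Fin m =>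
      completeHomogeneousSub p (lam.rowLen i + j) i).det = schurFunction p lam := by
    intro m hm
    induction m, hm using Nat.le_induction with
    | base => rfl
    | succ m hm ih =>
      have h0 : lam.rowLen m = 0 := by
        by_contra h
        have h1 := YoungDiagram.mem_iff_lt_rowLen.mpr (Nat.pos_of_ne_zero h)
        have h2 := YoungDiagram.mem_iff_lt_colLen.mp h1
        omega
      rw [Matrix.det_succ_row _ (Fin.last m), Fin.sum_univ_castSucc, Finset.sum_eq_zero]
      · rw [← ih, zero_add]
        have h1 : ((-1 : A)) ^ ((Fin.last m : ℕ) + (Fin.last m : ℕ)) = 1 := by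
          rw [← two_mul, pow_mul]; simp
        rw [h1, one_mul]
        have h2 : (Matrix.of fun i j : Fin (m + 1) =>
            completeHomogeneousSub p (lam.rowLen i + j) i) (Fin.last m) (Fin.last m) = 1 := by
          simp [h0, completeHomogeneousSub, completeHomogeneous]
        rw [h2, one_mul]
        congr 1
        ext i j
        simp
      · intro j _
        have h2 : (Matrix.of fun i j : Fin (m + 1) =>
            completeHomogeneousSub p (lam.rowLen i + j) i) (Fin.last m) j.castSucc = 0 := by
          simp [h0, completeHomogeneousSub]
        rw [h2]
        simp
  set E : Fin N → PowerSeries A := fun k =>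
    ∏ i ∈ Finset.univ.erase k, (1 - PowerSeries.C (x i) * PowerSeries.X) with hE
  have hcoeff : ∀ (k : Fin N) (m : ℕ), N ≤ m → PowerSeries.coeff m (E k) = 0 := by
    have key : ∀ (s : Finset (Fin N)) (m : ℕ), s.card < m →
        PowerSeries.coeff m (∏ i ∈ s, (1 - PowerSeries.C (x i) * PowerSeries.X)) = 0 := by
      intro s
      induction s using Finset.induction_on with
      | empty =>
        intro m hm
        rw [Finset.prod_empty, PowerSeries.coeff_one, if_neg]
        simp at hm
        omega
      | insert a s ha ih =>
        intro m hm
        rw [Finset.card_insert_of_notMem ha] at hm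
        obtain ⟨m, rfl⟩ : ∃ l, m = l + 1 := ⟨m - 1, by omega⟩
        rw [Finset.prod_insert ha, sub_mul, one_mul, map_sub, ih _ (by omega), mul_assoc,
          PowerSeries.coeff_C_mul, PowerSeries.coeff_succ_X_mul, ih _ (by omega)]
        simp
    intro k m hm
    apply key
    rw [Finset.card_erase_of_mem (Finset.mem_univ _), Finset.card_univ, Fintype.card_fin]
    have := k.2
    omega
  have hHE : ∀ k : Fin N, PowerSeries.mk (completeHomogeneous p) * E k =
      PowerSeries.mk (fun n => x k ^ n) := by
    intro k
    have h1 := completeHomogeneous_mk_mul_prod x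
    rw [← Finset.mul_prod_erase _ _ (Finset.mem_univ k)] at h1
    have h2 : PowerSeries.mk (fun n => x k ^ n) *
        (1 - PowerSeries.C (x k) * PowerSeries.X) = 1 := by
      ext n
      rw [mul_sub, mul_one, ← mul_assoc, map_sub]
      cases n with
      | zero => simp
      | succ n =>
        rw [PowerSeries.coeff_succ_mul_X, mul_comm, PowerSeries.coeff_C_mul]
        simp [PowerSeries.coeff_one]
        ring
    calc PowerSeries.mk (completeHomogeneous p) * E k
        = (PowerSeries.mk (fun n => x k ^ n) * (1 - PowerSeries.C (x k) * PowerSeries.X)) *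
            (PowerSeries.mk (completeHomogeneous p) * E k) := by rw [h2, one_mul]
      _ = PowerSeries.mk (fun n => x k ^ n) * (PowerSeries.mk (completeHomogeneous p) *
            ((1 - PowerSeries.C (x k) * PowerSeries.X) * E k)) := by ring
      _ = PowerSeries.mk (fun n => x k ^ n) := by rw [h1, mul_one]
  have hprod : ∀ l : ℕ → ℕ, (Matrix.of fun i j : Fin N =>
        completeHomogeneousSub p (l i + j) i) *
      (Matrix.of fun j k : Fin N => PowerSeries.coeff (N - 1 - (j : ℕ)) (E k)) =
      Matrix.of fun i k : Fin N => x k ^ (l i + (N - 1 - i)) := by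
    intro l
    ext i k
    have hi := i.2
    have h1 := congrArg (PowerSeries.coeff (l i + (N - 1 - i))) (hHE k)
    rw [mul_comm, PowerSeries.coeff_mk, PowerSeries.coeff_mul,
      Finset.Nat.sum_antidiagonal_eq_sum_range_succ_mk] at h1
    rw [Matrix.mul_apply, Matrix.of_apply, ← h1, ← Equiv.sum_comp Fin.revPerm]
    simp only [Matrix.of_apply, Fin.revPerm_apply, Fin.val_rev]
    have h3 : ∀ m : ℕ, m < N → N - 1 - (N - (m + 1)) = m := fun m hm => by omega
    rw [Finset.sum_congr rfl (g := fun j : Fin N =>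
      (fun m : ℕ => if m ≤ l i + (N - 1 - i) then PowerSeries.coeff m (E k) *
        completeHomogeneous p (l i + (N - 1 - i) - m) else 0) j)]
    · rw [← Finset.sum_range (fun m : ℕ => if m ≤ l i + (N - 1 - i) then
        PowerSeries.coeff m (E k) * completeHomogeneous p (l i + (N - 1 - i) - m) else 0),
        ← Finset.sum_filter]
      simp only [PowerSeries.coeff_mk]
      apply Finset.sum_subset
      · intro m hm
        simp at hm ⊢
        omega
      · intro m hm hm'
        simp at hm hm'
        rw [hcoeff k m (by omega), zero_mul]
    · intro j _
      have hj := j.2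
      rw [h3 _ hj, completeHomogeneousSub, mul_comm]
      beta_reduce
      by_cases hc : (j : ℕ) ≤ l i + (N - 1 - i)
      · rw [if_pos (by omega), if_pos hc]
        congr 2
        omega
      · rw [if_neg (by omega), if_neg hc, mul_zero]
  have hone : (Matrix.of fun i j : Fin N => completeHomogeneousSub p (0 + j) i).det = 1 := by
    rw [Matrix.det_of_isUpperTriangular]
    · simp [completeHomogeneousSub, completeHomogeneous]
    · intro i j hij
      have : (j : ℕ) < i := hij
      have hc : ¬ (i : ℕ) ≤ 0 + j := by omega
      rw [Matrix.of_apply, completeHomogeneousSub, if_neg hc]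
  have e0 := congrArg Matrix.det (hprod fun _ => 0)
  have e1 := congrArg Matrix.det (hprod lam.rowLen)
  rw [Matrix.det_mul] at e0 e1
  rw [hone, one_mul] at e0
  rw [hJT N hN, e0] at e1
  simpa using e1

end SchurFunctions

section PartitionFunction

variable {K : Type*} [Field K]

/-- The power sum `p_n(q^lam t^ρ)`, where `τ = t^{1/2}`:
`∑_{i=1}^{ℓ(lam)} (q^{n lam_i} - 1) t^{n (1/2 - i)} + 1 / (t^{n/2} - t^{-n/2})`. -/
def powerSumRho (q τ : K) (lam : YoungDiagram) (n : ℕ) : K :=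
  ∑ i ∈ Finset.range (lam.colLen 0),
      (q ^ (n * lam.rowLen i) - 1) * τ⁻¹ ^ (n * (2 * i + 1)) +
    1 / (τ ^ n - τ⁻¹ ^ n)

/-- The power sum `p_n(t^{-ρ}) = -1 / (t^{n/2} - t^{-n/2})`, where `τ = t^{1/2}`. -/
def powerSumNegRho (τ : K) (n : ℕ) : K :=
  -(1 / (τ ^ n - τ⁻¹ ^ n))

/-- The power sum `p_n(Q q^lam t^ρ, t^{-ρ}) = Q^n p_n(q^lam t^ρ) + p_n(t^{-ρ})`,
as a polynomial in the variable `Q`, where `τ = t^{1/2}`. -/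
def powerSumMixed (q τ : K) (lam : YoungDiagram) (n : ℕ) : Polynomial K :=
  Polynomial.X ^ n * Polynomial.C (powerSumRho q τ lam n) + Polynomial.C (powerSumNegRho τ n)

/-- The coefficient of `Q^|η|` in the weight of `η`:
`∏_{(i,j) ∈ η} 1 / ((1 - q^{η_i-j+1} t^{η'_j-i}) (1 - q^{-η_i+j} t^{-η'_j+i-1}))`. -/
def gikvWeight (q t : K) (eta : YoungDiagram) : K :=
  ∏ c ∈ eta.cells,
    1 / ((1 - q ^ ((eta.rowLen c.1 : ℤ) - (c.2 + 1) + 1) *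
            t ^ ((eta.colLen c.2 : ℤ) - (c.1 + 1))) *
         (1 - q ^ (-(eta.rowLen c.1 : ℤ) + (c.2 + 1)) *
            t ^ (-(eta.colLen c.2 : ℤ) + (c.1 + 1) - 1)))

/-- There are finitely many partitions of `n`. -/
theorem finite_setOf_card_eq (n : ℕ) : {eta : YoungDiagram | eta.card = n}.Finite := by
  have hcell : ∀ eta : YoungDiagram, ∀ c ∈ eta.cells, c.1 < eta.card ∧ c.2 < eta.card := by
    rintro eta ⟨i, j⟩ hc
    rw [YoungDiagram.mem_cells] at hc
    constructor
    · have h1 := YoungDiagram.mem_iff_lt_colLen.mp hc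
      rw [YoungDiagram.colLen_eq_card] at h1
      exact h1.trans_le (Finset.card_le_card (Finset.filter_subset _ _))
    · have h1 := YoungDiagram.mem_iff_lt_rowLen.mp hc
      rw [YoungDiagram.rowLen_eq_card] at h1
      exact h1.trans_le (Finset.card_le_card (Finset.filter_subset _ _))
  apply Set.Finite.of_finite_image (f := YoungDiagram.cells)
  · apply Set.Finite.subset (Finset.finite_toSet (Finset.range n ×ˢ Finset.range n).powerset)
    rintro _ ⟨eta, rfl, rfl⟩
    simp only [Finset.coe_powerset, Set.mem_preimage, Set.mem_powerset_iff, Finset.coe_subset]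
    intro c hc
    simpa using hcell eta c hc
  · intro a _ b _ h
    exact YoungDiagram.ext h

/-- `Z_{lam,mu}(Q; q, t)` with `t = τ ^ 2`, as a formal power series in `Q`:
the sum over all partitions `eta` of
`s_lam(q^eta t^ρ) s_mu(q^eta t^ρ)` times the weight of `eta` times `Q^|eta|`. -/
def gikvZ [CharZero K] (q τ : K) (lam mu : YoungDiagram) : PowerSeries K :=
  PowerSeries.mk fun n => ∑ eta ∈ (finite_setOf_card_eq n).toFinset,
    schurFunction (powerSumRho q τ eta) lam * schurFunction (powerSumRho q τ eta) mu *
      gikvWeight q (τ ^ 2) eta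

/-- `f(lam) = ∏_{(i,j) ∈ lam} (-1) q^{lam_i - lam'_j + i - j}`. -/
def framingFactor (q : K) (lam : YoungDiagram) : K :=
  ∏ c ∈ lam.cells,
    (-1) * q ^ ((lam.rowLen c.1 : ℤ) - lam.colLen c.2 + c.1 - c.2)

end PartitionFunction

end

/-! Write `r` for `q^{1/2}`. The bridge to finitely many variables is that at `Q = q^N`, with `N ≥
ℓ(lam)`, the power sums of `(Q q^lam q^ρ, q^{-ρ})` are those of the `N` variables `r q^{lam_i + N -
1 - i}` (`eval_powerSumMixed`). Schur functions at these points are quotients of the determinants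
`powDet`, whose entries are `q ^ (e_i f_k)`. Since `q` is not a root of unity, a polynomial in `Q`
is determined by its values at `q^N` for large `N`. Since the power sum `p_n` has degree at most `n`
in `Q`, the coefficient of top weight recovers the specialization `q^lam q^ρ`, and the constant
coefficient recovers `q^{-ρ}`.

Case `mu = ∅`. The hook-content formula gives the weight of `eta` as `s_eta(q^ρ) s_eta(q^{-ρ})`. The
symmetry of `powDet` exchanges `s_lam(q^eta q^ρ) s_eta(q^ρ)` for `s_lam(q^ρ) s_eta(q^lam q^ρ)`, and
the Cauchy identity sums the series. Passing from `∅` to `lam` multiplies the sum by the product of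
`1 - q^{j-i} Q` over the cells, which is `s_lam(Q q^ρ, q^{-ρ})` up to the framing factor and a
constant.

General case. The series is linear in the symmetric function `s_lam s_mu`, which is a combination of
single Schur functions (`schurFunction_mul_mem_span`). It remains to see that the right-hand side
also depends linearly on this product. At `Q = q^N` it is, up to a normalization independent of
`lam` and `mu`, a functional of random-matrix type whose moments are Gaussian, `(-1)^m q^{m²/2 -
(N-1)m}`. On `s_lam s_mu` this functional is `det g(a_i + b_k)`, where `g` is the moment sequence
and `a`, `b` are the shifted parts. Because `g(a + b) = g(a) g(b) q^{ab}`, this is `powDet` times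
framing factors (`symmetricMoment_gaussianMoment`). Thus the case `mu = ∅` implies all others
(`gikvZ_eq_mul`).

Degree. The top coefficient is a nonzero multiple of `s_mu(q^lam q^ρ)`. For `q` transcendental it is
nonzero, by comparing degrees in `q^{1/2}` at `Q = q^N` as `N` grows. -/

noncomputable section

open Polynomial

/-! ### Complete homogeneous functions and their generating series -/

section CompleteHomogeneous

variable {A B : Type*} [CommRing A] [Algebra ℚ A] [CommRing B] [Algebra ℚ B]

theorem completeHomogeneous_zero (p : ℕ → A) : completeHomogeneous p 0 = 1 := by
  rw [completeHomogeneous]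

theorem completeHomogeneous_succ (p : ℕ → A) (n : ℕ) :
    completeHomogeneous p (n + 1) = (1 / ((n : ℚ) + 1)) •
      ∑ k : Fin (n + 1), p (k.1 + 1) * completeHomogeneous p (n - k.1) := by
  rw [completeHomogeneous]

theorem completeHomogeneous_congr {p p' : ℕ → A} (h : ∀ n, 1 ≤ n → p n = p' n) (n : ℕ) :
    completeHomogeneous p n = completeHomogeneous p' n := by
  induction n using Nat.strong_induction_on with
  | _ n ih =>
    cases n with
    | zero => simp [completeHomogeneous_zero]
    | succ n =>
      rw [completeHomogeneous_succ, completeHomogeneous_succ]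
      congr 1
      refine Finset.sum_congr rfl fun k _ => ?_
      rw [h _ (by omega), ih _ (by omega)]

theorem schurFunction_congr {p p' : ℕ → A} (h : ∀ n, 1 ≤ n → p n = p' n) (lam : YoungDiagram) :
    schurFunction p lam = schurFunction p' lam := by
  simp only [schurFunction, completeHomogeneousSub, completeHomogeneous_congr h]

theorem map_completeHomogeneous (φ : A →+* B) (p : ℕ → A) (n : ℕ) :
    φ (completeHomogeneous p n) = completeHomogeneous (fun n => φ (p n)) n := by
  induction n using Nat.strong_induction_on with
  | _ n ih =>
    cases n with
    | zero => simp [completeHomogeneous_zero]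
    | succ n =>
      rw [completeHomogeneous_succ, completeHomogeneous_succ, map_rat_smul, map_sum]
      congr 1
      refine Finset.sum_congr rfl fun k _ => ?_
      rw [map_mul, ih _ (by omega)]

theorem map_completeHomogeneousSub (φ : A →+* B) (p : ℕ → A) (a b : ℕ) :
    φ (completeHomogeneousSub p a b) = completeHomogeneousSub (fun n => φ (p n)) a b := by
  simp only [completeHomogeneousSub, apply_ite φ, map_completeHomogeneous, map_zero]

theorem map_schurFunction (φ : A →+* B) (p : ℕ → A) (lam : YoungDiagram) :
    φ (schurFunction p lam) = schurFunction (fun n => φ (p n)) lam := by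
  rw [schurFunction, RingHom.map_det, schurFunction]
  congr 1
  ext i j
  simp [map_completeHomogeneousSub]

theorem derivative_mk_completeHomogeneous (p : ℕ → A) :
    PowerSeries.derivative A (PowerSeries.mk (completeHomogeneous p)) =
      PowerSeries.mk (fun n => p (n + 1)) * PowerSeries.mk (completeHomogeneous p) := by
  ext n
  have hn : ((1 / ((n : ℚ) + 1)) • ((n : A) + 1)) = 1 := by
    have h0 : ((n : ℚ) + 1) ≠ 0 := by positivity
    have h1 : ((n : A) + 1) = algebraMap ℚ A ((n : ℚ) + 1) := by simp
    rw [h1, Algebra.smul_def, ← map_mul, one_div, inv_mul_cancel₀ h0, map_one]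
  rw [PowerSeries.coeff_derivative, PowerSeries.coeff_mul, PowerSeries.coeff_mk,
    completeHomogeneous, smul_mul_assoc, mul_comm, ← smul_mul_assoc, hn, one_mul,
    Finset.Nat.sum_antidiagonal_eq_sum_range_succ_mk, Finset.sum_range]
  simp

/-- Uniqueness for the differential equation `F' = G F` with `F(0) = 1`: each coefficient is
determined by the previous ones, after dividing by `n + 1`. This replaces any use of the exponential
series. -/
theorem eq_mk_completeHomogeneous {p : ℕ → A} {F : PowerSeries A}
    (h0 : PowerSeries.constantCoeff F = 1)
    (hF : PowerSeries.derivative A F = PowerSeries.mk (fun n => p (n + 1)) * F) :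
    F = PowerSeries.mk (completeHomogeneous p) := by
  ext n
  induction n using Nat.strong_induction_on with
  | _ n ih =>
    cases n with
    | zero => simpa [completeHomogeneous_zero] using h0
    | succ n =>
      have h1 := congrArg (PowerSeries.coeff n) hF
      have h2 := congrArg (PowerSeries.coeff n) (derivative_mk_completeHomogeneous p)
      rw [PowerSeries.coeff_derivative, PowerSeries.coeff_mul] at h1 h2
      have h3 : ((n : A) + 1) * ((1 / ((n : ℚ) + 1)) • (1 : A)) = 1 := by
        have h0 : ((n : ℚ) + 1) ≠ 0 := by positivity
        have h1 : ((n : A) + 1) = algebraMap ℚ A ((n : ℚ) + 1) := by simp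
        rw [h1, Algebra.smul_def, mul_one, ← map_mul, one_div, mul_inv_cancel₀ h0, map_one]
      have h4 : PowerSeries.coeff (n + 1) F * ((n : A) + 1) =
          PowerSeries.coeff (n + 1) (PowerSeries.mk (completeHomogeneous p)) * ((n : A) + 1) := by
        rw [h1, h2]
        refine Finset.sum_congr rfl fun k hk => ?_
        rw [Finset.HasAntidiagonal.mem_antidiagonal] at hk
        rw [ih k.2 (by omega)]
      have h5 := congrArg (· * ((1 / ((n : ℚ) + 1)) • (1 : A))) h4
      simpa only [mul_assoc, h3, mul_one] using h5

/-- Adding power sums multiplies the generating functions of the `h_n`. -/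
theorem mk_completeHomogeneous_add (p p' : ℕ → A) :
    PowerSeries.mk (completeHomogeneous fun n => p n + p' n) =
      PowerSeries.mk (completeHomogeneous p) * PowerSeries.mk (completeHomogeneous p') := by
  symm
  apply eq_mk_completeHomogeneous
  · simp [completeHomogeneous_zero]
  · have h : PowerSeries.mk (fun n => p (n + 1) + p' (n + 1)) =
        PowerSeries.mk (fun n => p (n + 1)) + PowerSeries.mk (fun n => p' (n + 1)) := by
      ext n
      simp
    rw [h, Derivation.leibniz, derivative_mk_completeHomogeneous,
      derivative_mk_completeHomogeneous]
    simp only [smul_eq_mul]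
    ring

theorem mk_completeHomogeneous_zero :
    PowerSeries.mk (completeHomogeneous fun _ => (0 : A)) = 1 := by
  symm
  apply eq_mk_completeHomogeneous
  · simp
  · have h : PowerSeries.mk (fun _ : ℕ => (0 : A)) = 0 := by
      ext n
      simp
    rw [h]
    simp

theorem mk_completeHomogeneous_sum {ι : Type*} (s : Finset ι) (p : ι → ℕ → A) :
    PowerSeries.mk (completeHomogeneous fun n => ∑ i ∈ s, p i n) =
      ∏ i ∈ s, PowerSeries.mk (completeHomogeneous (p i)) := by
  classical
  induction s using Finset.induction_on with
  | empty => simpa using mk_completeHomogeneous_zero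
  | insert a s ha ih =>
    simp only [Finset.sum_insert ha, Finset.prod_insert ha]
    rw [mk_completeHomogeneous_add, ih]

theorem completeHomogeneous_pow_mul (c : A) (p : ℕ → A) (n : ℕ) :
    completeHomogeneous (fun n => c ^ n * p n) n = c ^ n * completeHomogeneous p n := by
  induction n using Nat.strong_induction_on with
  | _ n ih =>
    cases n with
    | zero => simp [completeHomogeneous_zero]
    | succ n =>
      rw [completeHomogeneous_succ, completeHomogeneous_succ, mul_smul_comm, Finset.mul_sum]
      congr 1
      refine Finset.sum_congr rfl fun k _ => ?_
      have hk : c ^ (n + 1) = c ^ (k.1 + 1) * c ^ (n - k.1) := by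
        rw [← pow_add]
        congr 1
        have := k.2
        omega
      rw [ih _ (by omega), hk]
      ring

/-- Power sums `-c^n` mean that the variable `c` is removed, so the series is the inverse of the
geometric series of `c`. These are the factors by which the partition function changes when cells
are added. -/
theorem mk_completeHomogeneous_neg_pow_mul (c : A) :
    PowerSeries.mk (completeHomogeneous fun n => -c ^ n) =
      1 - PowerSeries.C c * PowerSeries.X := by
  have h1 := completeHomogeneous_mk_mul_prod (N := 1) fun _ => c
  have h2 := mk_completeHomogeneous_add (fun n => -c ^ n) (fun n => c ^ n)
  simp only [neg_add_cancel, mk_completeHomogeneous_zero] at h2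
  simp only [Finset.univ_unique, Finset.sum_const, Finset.card_singleton, one_smul,
    Finset.prod_const, pow_one] at h1
  calc _ = PowerSeries.mk (completeHomogeneous fun n => -c ^ n) *
        (PowerSeries.mk (completeHomogeneous fun n => c ^ n) *
          (1 - PowerSeries.C c * PowerSeries.X)) := by rw [h1, mul_one]
    _ = _ := by rw [← mul_assoc, ← h2, one_mul]

end CompleteHomogeneous

/-! ### Rows, columns and cells of Young diagrams -/

section YoungDiagram

namespace YoungDiagram

theorem rowLen_eq_zero_of_colLen_le {lam : YoungDiagram} {m : ℕ} (hm : lam.colLen 0 ≤ m) :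
    lam.rowLen m = 0 := by
  by_contra h
  have h1 := YoungDiagram.mem_iff_lt_rowLen.mpr (Nat.pos_of_ne_zero h)
  have h2 := YoungDiagram.mem_iff_lt_colLen.mp h1
  omega

theorem cells_eq_sigma_map {lam : YoungDiagram} {N : ℕ} (hN : lam.colLen 0 ≤ N) :
    lam.cells = ((Finset.range N).sigma fun i => Finset.range (lam.rowLen i)).map
      (Equiv.sigmaEquivProd ℕ ℕ).toEmbedding := by
  ext ⟨i, j⟩
  simp only [mem_cells, Finset.mem_map_equiv, Finset.mem_sigma, Finset.mem_range,
    Equiv.sigmaEquivProd_symm_apply]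
  rw [mem_iff_lt_rowLen]
  refine ⟨fun h => ⟨?_, h⟩, fun h => h.2⟩
  by_contra hi
  rw [rowLen_eq_zero_of_colLen_le (by omega)] at h
  omega

theorem prod_cells {M : Type*} [CommMonoid M] {lam : YoungDiagram} {N : ℕ}
    (hN : lam.colLen 0 ≤ N) (F : ℕ → ℕ → M) :
    ∏ c ∈ lam.cells, F c.1 c.2 =
      ∏ i ∈ Finset.range N, ∏ j ∈ Finset.range (lam.rowLen i), F i j := by
  rw [cells_eq_sigma_map hN, Finset.prod_map, Finset.prod_sigma]
  rfl

theorem sum_cells {M : Type*} [AddCommMonoid M] {lam : YoungDiagram} {N : ℕ}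
    (hN : lam.colLen 0 ≤ N) (F : ℕ → ℕ → M) :
    ∑ c ∈ lam.cells, F c.1 c.2 =
      ∑ i ∈ Finset.range N, ∑ j ∈ Finset.range (lam.rowLen i), F i j :=
  prod_cells (M := Multiplicative M) hN F

theorem card_eq_sum_rowLen {lam : YoungDiagram} {N : ℕ} (hN : lam.colLen 0 ≤ N) :
    lam.card = ∑ i : Fin N, lam.rowLen i := by
  have h := sum_cells hN fun _ _ => 1
  rw [Finset.sum_const, smul_eq_mul, mul_one] at h
  rw [YoungDiagram.card, h, Finset.sum_range]
  simp

theorem colLen_zero_le_card (lam : YoungDiagram) : lam.colLen 0 ≤ lam.card := by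
  rw [colLen_eq_card]
  exact Finset.card_le_card (Finset.filter_subset _ _)

theorem ext_rowLen {lam mu : YoungDiagram} (h : ∀ i, lam.rowLen i = mu.rowLen i) : lam = mu := by
  ext ⟨i, j⟩
  rw [mem_cells, mem_cells, mem_iff_lt_rowLen, mem_iff_lt_rowLen, h]

theorem exists_rowLen_eq {n : ℕ} (a : Fin n → ℕ) (ha : Antitone a) :
    ∃ lam : YoungDiagram, lam.colLen 0 ≤ n ∧ ∀ i : Fin n, lam.rowLen i = a i := by
  refine ⟨ofRowLens (List.ofFn a) ha.sortedGE_ofFn, ?_, fun i => ?_⟩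
  · by_contra h
    have h1 := mem_iff_lt_colLen.mpr (not_le.mp h)
    rw [mem_ofRowLens] at h1
    obtain ⟨h2, -⟩ := h1
    simp at h2
  · have := rowLen_ofRowLens (w := List.ofFn a) (hw := ha.sortedGE_ofFn)
      (Fin.cast (List.length_ofFn).symm i)
    simpa using this

theorem rowLen_bot (i : ℕ) : (⊥ : YoungDiagram).rowLen i = 0 := by
  by_contra h
  exact notMem_bot _ (mem_iff_lt_rowLen.mpr (Nat.pos_of_ne_zero h))

theorem colLen_bot (i : ℕ) : (⊥ : YoungDiagram).colLen i = 0 := by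
  by_contra h
  exact notMem_bot _ (mem_iff_lt_colLen.mpr (Nat.pos_of_ne_zero h))

theorem card_bot : (⊥ : YoungDiagram).card = 0 := by
  simp [YoungDiagram.card]

end YoungDiagram

end YoungDiagram

/-! ### Stability of the Jacobi–Trudi determinant -/

section SchurFunction

variable {A : Type*} [CommRing A] [Algebra ℚ A]

/-- Each row added beyond the length of the diagram is `(0, …, 0, 1)`, so expanding along it removes
it again. -/
theorem schurFunction_eq_det (p : ℕ → A) {lam : YoungDiagram} {m : ℕ} (hm : lam.colLen 0 ≤ m) :
    schurFunction p lam = (Matrix.of fun i j : Fin m =>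
      completeHomogeneousSub p (lam.rowLen i + j) i).det := by
  induction m, hm using Nat.le_induction with
  | base => rfl
  | succ m hm ih =>
    have h0 := YoungDiagram.rowLen_eq_zero_of_colLen_le hm
    rw [Matrix.det_succ_row _ (Fin.last m), Fin.sum_univ_castSucc, Finset.sum_eq_zero]
    · rw [ih, zero_add]
      have h1 : ((-1 : A)) ^ ((Fin.last m : ℕ) + (Fin.last m : ℕ)) = 1 := by
        rw [← two_mul, pow_mul]; simp
      rw [h1, one_mul]
      have h2 : (Matrix.of fun i j : Fin (m + 1) =>
          completeHomogeneousSub p (lam.rowLen i + j) i) (Fin.last m) (Fin.last m) = 1 := by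
        simp [h0, completeHomogeneousSub, completeHomogeneous]
      rw [h2, one_mul]
      congr 1
      ext i j
      simp
    · intro j _
      have h2 : (Matrix.of fun i j : Fin (m + 1) =>
          completeHomogeneousSub p (lam.rowLen i + j) i) (Fin.last m) j.castSucc = 0 := by
        simp [h0, completeHomogeneousSub]
      rw [h2]
      simp

theorem schurFunction_bot (p : ℕ → A) : schurFunction p ⊥ = 1 := by
  rw [schurFunction_eq_det p (m := 0) (by rw [YoungDiagram.colLen_bot])]
  simp

end SchurFunction

/-! ### Weighted homogeneity and top coefficients -/

section Homogeneity

variable {K : Type*} [Field K]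

/-- `P` has degree at most `n` and its coefficient of degree `n` is `a`. -/
def HasTopCoeff (P : K[X]) (n : ℕ) (a : K) : Prop := P.natDegree ≤ n ∧ P.coeff n = a

namespace HasTopCoeff

theorem mul {P R : K[X]} {m n : ℕ} {a b : K} (hP : HasTopCoeff P m a) (hR : HasTopCoeff R n b) :
    HasTopCoeff (P * R) (m + n) (a * b) :=
  ⟨natDegree_mul_le_of_le hP.1 hR.1, by
    rw [coeff_mul_add_eq_of_natDegree_le hP.1 hR.1, hP.2, hR.2]⟩

theorem sum {ι : Type*} {s : Finset ι} {P : ι → K[X]} {n : ℕ} {a : ι → K}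
    (h : ∀ i ∈ s, HasTopCoeff (P i) n (a i)) : HasTopCoeff (∑ i ∈ s, P i) n (∑ i ∈ s, a i) :=
  ⟨natDegree_sum_le_of_forall_le _ _ fun i hi => (h i hi).1, by
    rw [finsetSum_coeff]
    exact Finset.sum_congr rfl fun i hi => (h i hi).2⟩

theorem prod {ι : Type*} {s : Finset ι} {P : ι → K[X]} {n : ι → ℕ} {a : ι → K}
    (h : ∀ i ∈ s, HasTopCoeff (P i) (n i) (a i)) :
    HasTopCoeff (∏ i ∈ s, P i) (∑ i ∈ s, n i) (∏ i ∈ s, a i) := by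
  classical
  induction s using Finset.induction_on with
  | empty => exact ⟨by simp, by simp⟩
  | insert b s hb ih =>
    rw [Finset.prod_insert hb, Finset.sum_insert hb, Finset.prod_insert hb]
    exact (h _ (Finset.mem_insert_self _ _)).mul
      (ih fun i hi => h i (Finset.mem_insert_of_mem hi))

theorem zero (n : ℕ) : HasTopCoeff (0 : K[X]) n 0 := ⟨by simp, by simp⟩

theorem intCast_mul {P : K[X]} {n : ℕ} {a : K} (z : ℤ) (h : HasTopCoeff P n a) :
    HasTopCoeff ((z : K[X]) * P) n ((z : K) * a) := by
  have h0 : HasTopCoeff (z : K[X]) 0 (z : K) := ⟨by simp, by simp⟩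
  simpa using h0.mul h

end HasTopCoeff

variable [CharZero K]

theorem hasTopCoeff_completeHomogeneous {p : ℕ → K[X]} {a : ℕ → K}
    (h : ∀ n, 1 ≤ n → HasTopCoeff (p n) n (a n)) (n : ℕ) :
    HasTopCoeff (completeHomogeneous p n) n (completeHomogeneous a n) := by
  induction n using Nat.strong_induction_on with
  | _ n ih =>
    cases n with
    | zero =>
      rw [completeHomogeneous_zero, completeHomogeneous_zero]
      exact ⟨by simp, by simp⟩
    | succ n =>
      rw [completeHomogeneous_succ, completeHomogeneous_succ]
      have h1 : HasTopCoeff (∑ k : Fin (n + 1), p (k.1 + 1) * completeHomogeneous p (n - k.1))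
          (n + 1) (∑ k : Fin (n + 1), a (k.1 + 1) * completeHomogeneous a (n - k.1)) := by
        apply HasTopCoeff.sum
        intro k _
        have := (h (k.1 + 1) (by omega)).mul (ih (n - k.1) (by omega))
        rwa [show k.1 + 1 + (n - k.1) = n + 1 by omega] at this
      exact ⟨(natDegree_smul_le _ _).trans h1.1, by rw [coeff_smul, h1.2]⟩

/-- A Schur function is homogeneous of weight `|lam|` when `p n` has weight `n`, so its top
coefficient is the same Schur function of the top coefficients. This turns identities in the
polynomial variable into identities at `q^lam q^ρ`. -/
theorem hasTopCoeff_schurFunction {p : ℕ → K[X]} {a : ℕ → K}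
    (h : ∀ n, 1 ≤ n → HasTopCoeff (p n) n (a n)) (lam : YoungDiagram) :
    HasTopCoeff (schurFunction p lam) lam.card (schurFunction a lam) := by
  rw [schurFunction, schurFunction, Matrix.det_apply', Matrix.det_apply']
  apply HasTopCoeff.sum
  intro σ _
  apply HasTopCoeff.intCast_mul
  simp only [Matrix.of_apply]
  -- Either no index `lam_{σ i} - σ i + i` is negative, and these indices add up to `|lam|`, or the
  -- whole product vanishes on both sides.
  by_cases hσ : ∀ i, (σ i : ℕ) ≤ lam.rowLen (σ i) + i
  · have hc : lam.card = ∑ i, (lam.rowLen (σ i) + i - (σ i : ℕ)) := by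
      have h1 : ∑ i, (lam.rowLen (σ i) + i - (σ i : ℕ)) + ∑ i, (σ i : ℕ) =
          lam.card + ∑ i : Fin (lam.colLen 0), (i : ℕ) := by
        rw [← Finset.sum_add_distrib, Finset.sum_congr rfl fun i _ => Nat.sub_add_cancel (hσ i),
          Finset.sum_add_distrib, Equiv.sum_comp σ fun i => lam.rowLen (i : ℕ),
          YoungDiagram.card_eq_sum_rowLen le_rfl]
      rw [Equiv.sum_comp σ fun i => (i : ℕ)] at h1
      omega
    rw [hc]
    apply HasTopCoeff.prod
    intro i _
    rw [completeHomogeneousSub, completeHomogeneousSub, if_pos (hσ i), if_pos (hσ i)]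
    exact hasTopCoeff_completeHomogeneous h _
  · push Not at hσ
    obtain ⟨i, hi⟩ := hσ
    rw [Finset.prod_eq_zero (Finset.mem_univ i), Finset.prod_eq_zero (Finset.mem_univ i)]
    · exact HasTopCoeff.zero _
    · rw [completeHomogeneousSub, if_neg (by omega)]
    · rw [completeHomogeneousSub, if_neg (by omega)]

end Homogeneity

/-! ### Products of Schur functions are combinations of Schur functions -/

section SchurSpan

variable {A : Type*} [CommRing A] [Algebra ℚ A]

/-- Put `c_i = a_i - i`, strictly decreasing, so that `b_i = c_{σ i} + i`. The sums of squares
differ by twice the difference of `∑ c_{σ i} i` and `∑ c_i i`, and the rearrangement inequality is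
strict for `σ ≠ 1`. This is the triangularity of the Jacobi–Trudi expansion. -/
theorem sum_sq_lt_sum_sq_of_antitone {n : ℕ} {a b : Fin n → ℕ} (ha : Antitone a)
    {σ : Equiv.Perm (Fin n)} (hσ : σ ≠ 1) (hb : ∀ i, b i + (σ i : ℕ) = a (σ i) + i) :
    ∑ i, a i ^ 2 < ∑ i, b i ^ 2 := by
  set c : Fin n → ℤ := fun i => (a i : ℤ) - (i : ℕ) with hc
  set g : Fin n → ℤ := fun i => ((i : ℕ) : ℤ) with hg
  have hcs : StrictAnti c := by
    intro i j hij
    have h1 := ha hij.le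
    have h2 : (i : ℕ) < j := hij
    simp only [hc]
    omega
  have hgs : StrictMono g := by
    intro i j hij
    have h2 : (i : ℕ) < j := hij
    simp only [hg]
    omega
  have hanti : Antivary c g := hcs.antitone.antivary hgs.monotone
  have h1 : ∑ i, c i * g i < ∑ i, c (σ i) * g i := by
    rw [hanti.sum_mul_lt_sum_comp_perm_mul_iff]
    intro h
    apply hσ
    rw [← Equiv.Perm.monotone_iff]
    intro i j hij
    rcases hij.eq_or_lt with rfl | hij
    · exact le_rfl
    · exact hcs.le_iff_ge.mp (h (hgs hij))
  have h2 : ∑ i, (a i : ℤ) ^ 2 = ∑ i, c i ^ 2 + ∑ i, g i ^ 2 + 2 * ∑ i, c i * g i := by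
    rw [Finset.mul_sum, ← Finset.sum_add_distrib, ← Finset.sum_add_distrib]
    refine Finset.sum_congr rfl fun i _ => ?_
    simp only [hc, hg]
    ring
  have h3 : ∑ i, (b i : ℤ) ^ 2 = ∑ i, c i ^ 2 + ∑ i, g i ^ 2 + 2 * ∑ i, c (σ i) * g i := by
    rw [← Equiv.sum_comp σ fun i => c i ^ 2, Finset.mul_sum, ← Finset.sum_add_distrib,
      ← Finset.sum_add_distrib]
    refine Finset.sum_congr rfl fun i _ => ?_
    have h4 : (b i : ℤ) = c (σ i) + g i := by
      have := hb i
      simp only [hc, hg]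
      omega
    rw [h4]
    ring
  have h4 : ∑ i, (a i : ℤ) ^ 2 < ∑ i, (b i : ℤ) ^ 2 := by
    rw [h2, h3]
    linarith
  exact_mod_cast h4

/-- After sorting the exponents, the identity permutation in the Jacobi–Trudi determinant gives this
very product. Every other nonzero term is a product of as many `h`'s with the same total degree and
a larger sum of squares. The induction is on `(∑ a)^2 - ∑ a^2`, which therefore decreases. -/
theorem prod_completeHomogeneous_mem_span (p : ℕ → A) {n : ℕ} (a : Fin n → ℕ) :
    ∏ i, completeHomogeneous p (a i) ∈ Submodule.span ℚ (Set.range (schurFunction p)) := by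
  obtain ⟨m, hm⟩ : ∃ m, (∑ i, a i) ^ 2 - ∑ i, a i ^ 2 = m := ⟨_, rfl⟩
  induction m using Nat.strong_induction_on generalizing a with
  | _ m ih =>
    obtain ⟨τ, hτ⟩ : ∃ τ : Equiv.Perm (Fin n), Antitone (a ∘ τ) := by
      refine ⟨Fin.revPerm.trans (Tuple.sort a), ?_⟩
      intro i j hij
      exact Tuple.monotone_sort a (Fin.rev_le_rev.mpr hij)
    rw [← Equiv.prod_comp τ]
    rw [← Equiv.sum_comp τ a, ← Equiv.sum_comp τ fun i => a i ^ 2] at hm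
    set b := a ∘ τ with hb
    change (∑ i, b i) ^ 2 - ∑ i, b i ^ 2 = m at hm
    change ∏ i, completeHomogeneous p (b i) ∈ _
    obtain ⟨lam, hlen, hlam⟩ := YoungDiagram.exists_rowLen_eq b hτ
    have hdet : schurFunction p lam = ∑ σ : Equiv.Perm (Fin n), (Equiv.Perm.sign σ : ℤ) •
        ∏ i, completeHomogeneousSub p (b (σ i) + i) (σ i) := by
      rw [schurFunction_eq_det p hlen, Matrix.det_apply']
      refine Finset.sum_congr rfl fun σ _ => ?_
      rw [zsmul_eq_mul]
      simp [hlam]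
    rw [← Finset.add_sum_erase _ _ (Finset.mem_univ (1 : Equiv.Perm (Fin n)))] at hdet
    have h1 : ((Equiv.Perm.sign (1 : Equiv.Perm (Fin n)) : ℤˣ) : ℤ) •
        ∏ i : Fin n, completeHomogeneousSub p (b ((1 : Equiv.Perm (Fin n)) i) + i)
          ((1 : Equiv.Perm (Fin n)) i) = ∏ i, completeHomogeneous p (b i) := by
      simp [completeHomogeneousSub]
    rw [h1] at hdet
    rw [← sub_eq_iff_eq_add] at hdet
    rw [← hdet]
    refine sub_mem (Submodule.subset_span ⟨lam, rfl⟩) (sum_mem fun σ hσ => zsmul_mem ?_ _)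
    have hσ1 := Finset.ne_of_mem_erase hσ
    by_cases hpos : ∀ i, (σ i : ℕ) ≤ b (σ i) + i
    · set d : Fin n → ℕ := fun i => b (σ i) + i - σ i with hd
      have hdb : ∀ i, d i + (σ i : ℕ) = b (σ i) + i := fun i => Nat.sub_add_cancel (hpos i)
      have h2 : ∏ i, completeHomogeneousSub p (b (σ i) + i) (σ i) =
          ∏ i, completeHomogeneous p (d i) :=
        Finset.prod_congr rfl fun i _ => if_pos (hpos i)
      rw [h2]
      have h3 := sum_sq_lt_sum_sq_of_antitone hτ hσ1 hdb
      have h4 : ∑ i, d i = ∑ i, b i := by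
        have h5 : ∑ i, d i + ∑ i, (σ i : ℕ) = ∑ i, b (σ i) + ∑ i : Fin n, (i : ℕ) := by
          rw [← Finset.sum_add_distrib, ← Finset.sum_add_distrib]
          exact Finset.sum_congr rfl fun i _ => hdb i
        rw [Equiv.sum_comp σ fun i => (i : ℕ), Equiv.sum_comp σ b] at h5
        omega
      have h6 : ∑ i, d i ^ 2 ≤ (∑ i, d i) ^ 2 :=
        Finset.sum_sq_le_sq_sum_of_nonneg fun i _ => Nat.zero_le _
      rw [h4] at h6
      refine ih _ ?_ d rfl
      rw [h4, ← hm]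
      change ∑ i, b i ^ 2 < _ at h3
      omega
    · push Not at hpos
      obtain ⟨i, hi⟩ := hpos
      rw [Finset.prod_eq_zero (Finset.mem_univ i)]
      · exact zero_mem _
      · rw [completeHomogeneousSub, if_neg (by omega)]

/-- A product of two Schur functions is a linear combination of Schur functions. -/
theorem schurFunction_mul_mem_span (p : ℕ → A) (lam mu : YoungDiagram) :
    schurFunction p lam * schurFunction p mu ∈
      Submodule.span ℚ (Set.range (schurFunction p)) := by
  set R := Algebra.adjoin ℚ (Set.range (completeHomogeneous p)) with hR
  have h1 : ∀ nu, schurFunction p nu ∈ R := by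
    intro nu
    rw [schurFunction, Matrix.det_apply]
    refine sum_mem fun σ _ => ?_
    rw [Units.smul_def]
    refine zsmul_mem (prod_mem fun i _ => ?_) _
    rw [Matrix.of_apply, completeHomogeneousSub]
    split_ifs
    · exact Algebra.subset_adjoin ⟨_, rfl⟩
    · exact zero_mem _
  have h2 : Subalgebra.toSubmodule R ≤ Submodule.span ℚ (Set.range (schurFunction p)) := by
    rw [hR, Algebra.adjoin_eq_span, Submodule.span_le]
    intro x hx
    obtain ⟨l, hl, rfl⟩ := Submonoid.exists_list_of_mem_closure hx
    choose! f hf using hl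
    have h3 : l = List.ofFn fun i : Fin l.length => completeHomogeneous p (f (l.get i)) := by
      apply List.ext_get
      · simp
      · intro i h1 h2
        simp [hf _ (List.getElem_mem h1)]
    rw [h3, List.prod_ofFn]
    exact prod_completeHomogeneous_mem_span p _
  exact h2 ((Subalgebra.mem_toSubmodule _).mpr (mul_mem (h1 lam) (h1 mu)))

end SchurSpan

/-- The strictly decreasing sequence `lam_i + N - 1 - i`. -/
def shiftedPart (lam : YoungDiagram) (N : ℕ) (i : Fin N) : ℕ := lam.rowLen i + (N - 1 - i)

theorem shiftedPart_strictAnti (lam : YoungDiagram) (N : ℕ) : StrictAnti (shiftedPart lam N) := by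
  intro i j hij
  have h1 : (i : ℕ) < j := hij
  have h2 := lam.rowLen_anti i j h1.le
  have h3 := j.2
  simp only [shiftedPart]
  omega

theorem shiftedPart_bot (N : ℕ) (i : Fin N) : shiftedPart ⊥ N i = N - 1 - i := by
  rw [shiftedPart, YoungDiagram.rowLen_bot, zero_add]

theorem shiftedPart_eq_add (lam : YoungDiagram) (N : ℕ) (i : Fin N) :
    shiftedPart lam N i = lam.rowLen i + shiftedPart ⊥ N i := by
  rw [shiftedPart_bot, shiftedPart]

theorem sum_shiftedPart {lam : YoungDiagram} {N : ℕ} (hN : lam.colLen 0 ≤ N) :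
    ∑ i, shiftedPart lam N i = lam.card + ∑ i, shiftedPart ⊥ N i := by
  rw [YoungDiagram.card_eq_sum_rowLen hN, ← Finset.sum_add_distrib]
  exact Finset.sum_congr rfl fun i _ => shiftedPart_eq_add lam N i

/-! ### Determinants with entries `q ^ (e_i f_k)` -/

section PowDet

variable {R : Type*} [CommRing R]

/-- The determinant of the matrix with entries `q ^ (e_i f_k)`. -/
def powDet (q : R) {N : ℕ} (e f : Fin N → ℕ) : R :=
  (Matrix.of fun i k : Fin N => q ^ (e i * f k)).det

theorem powDet_comm (q : R) {N : ℕ} (e f : Fin N → ℕ) : powDet q e f = powDet q f e := by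
  rw [powDet, ← Matrix.det_transpose, powDet]
  congr 1
  ext i k
  simp [mul_comm]

theorem det_mul_pow {N : ℕ} (c q : R) (e f : Fin N → ℕ) :
    (Matrix.of fun i k : Fin N => (c * q ^ f k) ^ e i).det =
      c ^ (∑ i, e i) * powDet q e f := by
  rw [powDet, ← Finset.prod_pow_eq_pow_sum, ← Matrix.det_mul_column]
  congr 1
  ext i k
  simp [mul_pow, ← pow_mul, mul_comm]

theorem powDet_shiftedPart_bot (q : R) {N : ℕ} (f : Fin N → ℕ) :
    powDet q (shiftedPart ⊥ N) f = ∏ i, ∏ j ∈ Finset.Ioi i, (q ^ f i - q ^ f j) := by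
  have h : powDet q (shiftedPart ⊥ N) f =
      (Matrix.projVandermonde (fun _ => 1) fun k => q ^ f k).det := by
    rw [powDet, ← Matrix.det_transpose]
    congr 1
    ext i k
    simp only [Matrix.transpose_apply, Matrix.of_apply, Matrix.projVandermonde_apply, one_pow,
      one_mul, shiftedPart_bot, Fin.val_rev, ← pow_mul]
    congr 1
    rw [mul_comm]
    congr 1
    omega
  rw [h, Matrix.det_projVandermonde]
  simp

end PowDet

/-! ### Specialization at `Q = q ^ N` and the resulting symmetry -/

section Evaluation

variable {K : Type*} [Field K] {q r : K}

theorem ne_zero_of_sq_eq (hr : r ^ 2 = q) (hq0 : q ≠ 0) : r ≠ 0 := by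
  rintro rfl
  simp at hr
  exact hq0 hr.symm

theorem pow_injective_of_pow_ne_one (hq0 : q ≠ 0) (hq : ∀ n : ℕ, 1 ≤ n → q ^ n ≠ 1) :
    Function.Injective fun n : ℕ => q ^ n := by
  have key : ∀ m k : ℕ, q ^ m = q ^ (m + k) → k = 0 := by
    intro m k h
    rw [pow_add] at h
    by_contra hk
    exact hq k (by omega) (mul_left_cancel₀ (pow_ne_zero m hq0) (by rw [← h, mul_one]))
  intro m n h
  rcases le_total m n with hmn | hmn
  · obtain ⟨k, rfl⟩ := Nat.exists_eq_add_of_le hmn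
    rw [key m k h, add_zero]
  · obtain ⟨k, rfl⟩ := Nat.exists_eq_add_of_le hmn
    rw [key n k h.symm, add_zero]

/-- The powers of `q` are pairwise distinct, so all large `N` provide infinitely many points. Every
identity in the formal variable is reduced by this to finitely many variables. -/
theorem polynomial_eq_of_eval_pow_eq (hq0 : q ≠ 0) (hq : ∀ n : ℕ, 1 ≤ n → q ^ n ≠ 1)
    {P R : K[X]} (N₀ : ℕ) (h : ∀ N, N₀ ≤ N → P.eval (q ^ N) = R.eval (q ^ N)) : P = R := by
  apply Polynomial.eq_of_infinite_eval_eq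
  refine Set.Infinite.mono ?_
    ((Set.Ici_infinite N₀).image (pow_injective_of_pow_ne_one hq0 hq).injOn)
  rintro _ ⟨N, hN, rfl⟩
  exact h N hN

theorem powDet_shiftedPart_bot_ne_zero (hq0 : q ≠ 0) (hq : ∀ n : ℕ, 1 ≤ n → q ^ n ≠ 1)
    {N : ℕ} {f : Fin N → ℕ} (hf : Function.Injective f) :
    powDet q (shiftedPart ⊥ N) f ≠ 0 := by
  rw [powDet_shiftedPart_bot]
  refine Finset.prod_ne_zero_iff.mpr fun i _ => Finset.prod_ne_zero_iff.mpr fun j hj => ?_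
  rw [sub_ne_zero]
  intro h
  exact (Finset.mem_Ioi.mp hj).ne (hf (pow_injective_of_pow_ne_one hq0 hq h))

theorem pow_sub_inv_pow_ne_zero (hr : r ^ 2 = q) (hq0 : q ≠ 0)
    (hq : ∀ n : ℕ, 1 ≤ n → q ^ n ≠ 1) {n : ℕ} (hn : 1 ≤ n) : r ^ n - r⁻¹ ^ n ≠ 0 := by
  have hr0 := ne_zero_of_sq_eq hr hq0
  intro h
  apply hq n hn
  rw [← hr, ← pow_mul, mul_comm, pow_mul, sq, ← sub_eq_zero]
  have h1 : r ^ n * r⁻¹ ^ n = 1 := by rw [← mul_pow, mul_inv_cancel₀ hr0, one_pow]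
  linear_combination r ^ n * h + h1

/-- With `u = q^{n/2}`, multiplying by `u^{2N}` shows that the two fractions in the mixed power sum
at `Q = q^N` combine into a finite geometric sum; this cuts the infinite alphabet down to `N`
variables. -/
theorem sum_inv_pow_odd (u : K) (hu0 : u ≠ 0) (hu : u - u⁻¹ ≠ 0) (N : ℕ) :
    ∑ i ∈ Finset.range N, u⁻¹ ^ (2 * i + 1) = (1 - u⁻¹ ^ (2 * N)) * (1 / (u - u⁻¹)) := by
  have h1 : (u - u⁻¹) * (1 / (u - u⁻¹)) = 1 := by rw [mul_one_div, div_self hu]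
  have h2 : u * u⁻¹ = 1 := mul_inv_cancel₀ hu0
  induction N with
  | zero => simp
  | succ N ih =>
    rw [Finset.sum_range_succ, ih]
    have h3 : u⁻¹ ^ (2 * (N + 1)) = u⁻¹ ^ (2 * N) * u⁻¹ ^ 2 := by rw [← pow_add]; rfl
    have h4 : u⁻¹ ^ (2 * N + 1) = u⁻¹ ^ (2 * N) * u⁻¹ := pow_succ _ _
    rw [h3, h4]
    linear_combination (-u⁻¹ ^ (2 * N) * u⁻¹) * h1 + u⁻¹ ^ (2 * N) * (1 / (u - u⁻¹)) * h2

theorem powerSumRho_eq_sum_range (q r : K) {lam : YoungDiagram} {N : ℕ}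
    (hN : lam.colLen 0 ≤ N) (n : ℕ) :
    powerSumRho q r lam n = ∑ i ∈ Finset.range N,
      (q ^ (n * lam.rowLen i) - 1) * r⁻¹ ^ (n * (2 * i + 1)) + 1 / (r ^ n - r⁻¹ ^ n) := by
  rw [powerSumRho]
  congr 1
  apply Finset.sum_subset (Finset.range_mono hN)
  intro i _ hi
  rw [Finset.mem_range, not_lt] at hi
  have h0 : lam.rowLen i = 0 :=
    Nat.le_zero.mp ((lam.rowLen_anti _ _ hi).trans
      (YoungDiagram.rowLen_eq_zero_of_colLen_le le_rfl).le)
  simp [h0]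

/-- At `Q = q ^ N` the mixed power sums are the power sums of `N` variables. -/
theorem eval_powerSumMixed (hr : r ^ 2 = q) (hq0 : q ≠ 0) (hq : ∀ n : ℕ, 1 ≤ n → q ^ n ≠ 1)
    {lam : YoungDiagram} {N : ℕ} (hN : lam.colLen 0 ≤ N) {n : ℕ} (hn : 1 ≤ n) :
    (powerSumMixed q r lam n).eval (q ^ N) = ∑ i, (r * q ^ shiftedPart lam N i) ^ n := by
  have hr0 := ne_zero_of_sq_eq hr hq0
  have hu0 : r ^ n ≠ 0 := pow_ne_zero _ hr0
  have hu : r ^ n - (r ^ n)⁻¹ ≠ 0 := by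
    rw [← inv_pow]
    exact pow_sub_inv_pow_ne_zero hr hq0 hq hn
  rw [powerSumMixed, powerSumNegRho, powerSumRho_eq_sum_range q r hN]
  simp only [eval_add, eval_mul, eval_pow, eval_X, eval_C, shiftedPart]
  rw [← Finset.sum_range fun i => (r * q ^ (lam.rowLen i + (N - 1 - i))) ^ n]
  have hsum := sum_inv_pow_odd (r ^ n) hu0 hu N
  have hqn : q ^ n = (r ^ n) ^ 2 := by rw [← hr, ← pow_mul, ← pow_mul, mul_comm]
  simp only [inv_pow, pow_mul, mul_pow, ← pow_mul q _ n, mul_comm _ n] at hsum ⊢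
  simp only [hqn]
  set u := r ^ n with hu'
  have h1 : (u ^ 2) ^ N * (u ^ (2 * N))⁻¹ = 1 := by
    rw [← pow_mul, mul_inv_cancel₀ (pow_ne_zero _ hu0)]
  have h2 : ∀ i ∈ Finset.range N, u * (u ^ 2) ^ (lam.rowLen i + (N - 1 - i)) =
      (u ^ 2) ^ N * ((((u ^ 2) ^ lam.rowLen i) - 1) * (u ^ (2 * i + 1))⁻¹) +
        (u ^ 2) ^ N * (u ^ (2 * i + 1))⁻¹ := by
    intro i hi
    rw [Finset.mem_range] at hi
    have h3 : (u ^ 2) ^ N = u * (u ^ 2) ^ (N - 1 - i) * u ^ (2 * i + 1) := by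
      rw [← pow_mul u 2 N, ← pow_mul u 2 (N - 1 - i), ← pow_succ', ← pow_add]
      congr 1
      omega
    have h4 : u ^ (2 * i + 1) * (u ^ (2 * i + 1))⁻¹ = 1 := mul_inv_cancel₀ (pow_ne_zero _ hu0)
    rw [h3, pow_add]
    linear_combination (-u * (u ^ 2) ^ lam.rowLen i * (u ^ 2) ^ (N - 1 - i)) * h4
  rw [Finset.sum_congr rfl h2, Finset.sum_add_distrib, ← Finset.mul_sum, ← Finset.mul_sum]
  have h5 : ∑ i ∈ Finset.range N, (u ^ (2 * i + 1))⁻¹ =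
      (1 - (u ^ (2 * N))⁻¹) * (1 / (u - u⁻¹)) := by
    simpa only [inv_pow] using sum_inv_pow_odd u hu0 hu N
  rw [h5]
  linear_combination (1 / (u - u⁻¹)) * h1

theorem hasTopCoeff_powerSumMixed (q r : K) (lam : YoungDiagram) {n : ℕ} (hn : 1 ≤ n) :
    HasTopCoeff (powerSumMixed q r lam n) n (powerSumRho q r lam n) := by
  constructor
  · rw [powerSumMixed]
    refine (natDegree_add_le _ _).trans (max_le ?_ ?_)
    · refine natDegree_mul_le_of_le (m := n) (n := 0) ?_ ?_
      · simp
      · simp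
    · simp
  · simp [powerSumMixed, coeff_C, show n ≠ 0 by omega]

variable [CharZero K]

/-- Evaluating `s_mu(Q q^lam q^ρ, q^{-ρ})` at `Q = q ^ N`. -/
theorem eval_schurFunction_powerSumMixed (hr : r ^ 2 = q) (hq0 : q ≠ 0)
    (hq : ∀ n : ℕ, 1 ≤ n → q ^ n ≠ 1) {lam mu : YoungDiagram} {N : ℕ}
    (hlam : lam.colLen 0 ≤ N) (hmu : mu.colLen 0 ≤ N) :
    (schurFunction (powerSumMixed q r lam) mu).eval (q ^ N) *
        powDet q (shiftedPart ⊥ N) (shiftedPart lam N) =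
      r ^ mu.card * powDet q (shiftedPart mu N) (shiftedPart lam N) := by
  have hr0 := ne_zero_of_sq_eq hr hq0
  have h1 := map_schurFunction (evalRingHom (q ^ N)) (powerSumMixed q r lam) mu
  rw [coe_evalRingHom] at h1
  rw [h1, schurFunction_congr fun n hn => eval_powerSumMixed hr hq0 hq hlam hn]
  have h2 := schurFunction_mul_alternant mu hmu fun i => r * q ^ shiftedPart lam N i
  have h3 := det_mul_pow r q (shiftedPart ⊥ N) (shiftedPart lam N)
  have h4 := det_mul_pow r q (shiftedPart mu N) (shiftedPart lam N)
  simp only [shiftedPart_bot] at h3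
  have h5 : (Matrix.of fun i k : Fin N =>
      (r * q ^ shiftedPart lam N k) ^ (mu.rowLen i + (N - 1 - i))).det =
      (Matrix.of fun i k : Fin N => (r * q ^ shiftedPart lam N k) ^ shiftedPart mu N i).det := rfl
  rw [h3, h5, h4, sum_shiftedPart hmu] at h2
  simp only [shiftedPart_bot] at h2
  refine mul_left_cancel₀ (pow_ne_zero (∑ i : Fin N, (N - 1 - (i : ℕ))) hr0) ?_
  rw [pow_add] at h2
  linear_combination h2

/-- The two factors are `powDet(lam, ∅) / powDet(∅, ∅)` and `powDet(mu, lam) / powDet(∅, lam)` up to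
powers of `r`. As `powDet` is symmetric, the product telescopes to an expression symmetric in `lam`
and `mu`. -/
theorem eval_schurFunction_powerSumMixed_mul (hr : r ^ 2 = q) (hq0 : q ≠ 0)
    (hq : ∀ n : ℕ, 1 ≤ n → q ^ n ≠ 1) {lam mu : YoungDiagram} {N : ℕ}
    (hlam : lam.colLen 0 ≤ N) (hmu : mu.colLen 0 ≤ N) :
    (schurFunction (powerSumMixed q r ⊥) lam).eval (q ^ N) *
        (schurFunction (powerSumMixed q r lam) mu).eval (q ^ N) *
        powDet q (shiftedPart ⊥ N) (shiftedPart ⊥ N) =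
      r ^ (lam.card + mu.card) * powDet q (shiftedPart lam N) (shiftedPart mu N) := by
  have h1 := eval_schurFunction_powerSumMixed hr hq0 hq hlam hmu
  have h2 := eval_schurFunction_powerSumMixed hr hq0 hq (lam := ⊥)
    (by rw [YoungDiagram.colLen_bot]; omega) hlam
  rw [powDet_comm q (shiftedPart lam N)] at h2
  rw [powDet_comm q (shiftedPart mu N)] at h1
  rw [pow_add]
  linear_combination (schurFunction (powerSumMixed q r lam) mu).eval (q ^ N) * h2 +
    r ^ lam.card * h1

theorem schurFunction_powerSumMixed_mul_comm (hr : r ^ 2 = q) (hq0 : q ≠ 0)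
    (hq : ∀ n : ℕ, 1 ≤ n → q ^ n ≠ 1) (lam mu : YoungDiagram) :
    schurFunction (powerSumMixed q r ⊥) lam * schurFunction (powerSumMixed q r lam) mu =
      schurFunction (powerSumMixed q r ⊥) mu * schurFunction (powerSumMixed q r mu) lam := by
  apply polynomial_eq_of_eval_pow_eq hq0 hq (max (lam.colLen 0) (mu.colLen 0))
  intro N hN
  have hlam := (le_max_left _ _).trans hN
  have hmu := (le_max_right _ _).trans hN
  refine mul_right_cancel₀ (powDet_shiftedPart_bot_ne_zero hq0 hq
    (shiftedPart_strictAnti ⊥ N).injective) ?_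
  rw [eval_mul, eval_mul, eval_schurFunction_powerSumMixed_mul hr hq0 hq hlam hmu,
    eval_schurFunction_powerSumMixed_mul hr hq0 hq hmu hlam, powDet_comm, add_comm]

theorem hasTopCoeff_schurFunction_powerSumMixed (q r : K) (lam mu : YoungDiagram) :
    HasTopCoeff (schurFunction (powerSumMixed q r lam) mu) mu.card
      (schurFunction (powerSumRho q r lam) mu) :=
  hasTopCoeff_schurFunction (fun _ hn => hasTopCoeff_powerSumMixed q r lam hn) mu

theorem coeff_zero_schurFunction_powerSumMixed (q r : K) (lam mu : YoungDiagram) :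
    (schurFunction (powerSumMixed q r lam) mu).coeff 0 = schurFunction (powerSumNegRho r) mu := by
  have h := map_schurFunction (constantCoeff (R := K)) (powerSumMixed q r lam) mu
  rw [constantCoeff_apply] at h
  rw [h]
  apply schurFunction_congr
  intro n hn
  simp [powerSumMixed, show 0 ≠ n by omega]

/-- The symmetry `s_lam(q^ρ) s_mu(q^lam q^ρ) = s_mu(q^ρ) s_lam(q^mu q^ρ)`. -/
theorem schurFunction_powerSumRho_mul_comm (hr : r ^ 2 = q) (hq0 : q ≠ 0)
    (hq : ∀ n : ℕ, 1 ≤ n → q ^ n ≠ 1) (lam mu : YoungDiagram) :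
    schurFunction (powerSumRho q r ⊥) lam * schurFunction (powerSumRho q r lam) mu =
      schurFunction (powerSumRho q r ⊥) mu * schurFunction (powerSumRho q r mu) lam := by
  -- Both sides are coefficients of degree `|lam| + |mu|` of the polynomial identity
  -- `schurFunction_powerSumMixed_mul_comm`.
  have h1 := ((hasTopCoeff_schurFunction_powerSumMixed q r ⊥ lam).mul
    (hasTopCoeff_schurFunction_powerSumMixed q r lam mu)).2
  have h2 := ((hasTopCoeff_schurFunction_powerSumMixed q r ⊥ mu).mul
    (hasTopCoeff_schurFunction_powerSumMixed q r mu lam)).2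
  rw [← h1, ← h2, schurFunction_powerSumMixed_mul_comm hr hq0 hq, add_comm]

end Evaluation

/-! ### Combinatorics of hook lengths -/

namespace YoungDiagram

/-- The hook length of the cell `(i, j)` of `lam`. -/
def hookLen (lam : YoungDiagram) (i j : ℕ) : ℕ :=
  (lam.rowLen i - j) + (lam.colLen j - (i + 1))

section Hooks

variable {M : Type*} [CommMonoid M]

/-- The hook lengths of a row and the differences of shifted parts are together
`1, …, lam_i + N - 1 - i`. -/
theorem prod_hookLen_row {lam : YoungDiagram} {N : ℕ} (hN : lam.colLen 0 ≤ N) (i : Fin N)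
    (g : ℕ → M) :
    (∏ j ∈ Finset.range (lam.rowLen i), g (lam.hookLen i j)) *
        ∏ k ∈ Finset.Ioi i, g (shiftedPart lam N i - shiftedPart lam N k) =
      ∏ m ∈ Finset.range (shiftedPart lam N i), g (m + 1) := by
  have hiN := i.2
  have hcol : ∀ j, j < lam.rowLen i → (i : ℕ) < lam.colLen j := fun j hj =>
    mem_iff_lt_colLen.mp (mem_iff_lt_rowLen.mpr hj)
  have hcolN : ∀ j, lam.colLen j ≤ N := fun j => (lam.colLen_anti 0 j (Nat.zero_le _)).trans hN
  have hA : Set.InjOn (fun j => lam.hookLen i j) (Finset.range (lam.rowLen i)) := by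
    have : StrictAntiOn (fun j => lam.hookLen i j) (Finset.range (lam.rowLen i)) := by
      intro j hj j' hj' hlt
      simp only [Finset.coe_range, Set.mem_Iio] at hj hj'
      have h1 := hcol j hj
      have h2 := hcol j' hj'
      have h3 := lam.colLen_anti j j' hlt.le
      simp only [hookLen]
      omega
    exact this.injOn
  have hB : Set.InjOn (fun k => shiftedPart lam N i - shiftedPart lam N k)
      (Finset.Ioi i : Finset (Fin N)) := by
    intro k hk k' hk' h
    have h1 := shiftedPart_strictAnti lam N (Finset.mem_Ioi.mp hk)
    have h2 := shiftedPart_strictAnti lam N (Finset.mem_Ioi.mp hk')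
    apply (shiftedPart_strictAnti lam N).injective
    dsimp only at h
    omega
  have hdisj : Disjoint
      ((Finset.range (lam.rowLen i)).image fun j => lam.hookLen i j)
      ((Finset.Ioi i).image fun k => shiftedPart lam N i - shiftedPart lam N k) := by
    rw [Finset.disjoint_left]
    intro m hm hm'
    rw [Finset.mem_image] at hm hm'
    obtain ⟨j, hj, rfl⟩ := hm
    obtain ⟨k, hk, hkj⟩ := hm'
    rw [Finset.mem_range] at hj
    have h1 := hcol j hj
    have h2 : i < k := Finset.mem_Ioi.mp hk
    rw [Fin.lt_def] at h2
    have h3 := lam.rowLen_anti i k h2.le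
    have h4 : j < lam.rowLen k ↔ (k : ℕ) < lam.colLen j :=
      mem_iff_lt_rowLen.symm.trans mem_iff_lt_colLen
    have h5 := k.2
    simp only [hookLen, shiftedPart] at hkj
    omega
  rw [← Finset.prod_image (f := g) hA, ← Finset.prod_image (f := g) hB, ← Finset.prod_union,
    ← Finset.prod_image (s := Finset.range (shiftedPart lam N i)) (f := g) (g := fun m => m + 1)
      (fun a _ b _ h => by simpa using h)]
  · congr 1
    -- The two sets of values are disjoint and lie in `{1, …, lam_i + N - 1 - i}`; their sizes
    -- `lam_i` and `N - 1 - i` fill it.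
    apply Finset.eq_of_subset_of_card_le
    · intro m hm
      rw [Finset.mem_union, Finset.mem_image, Finset.mem_image] at hm
      rw [Finset.mem_image]
      rcases hm with ⟨j, hj, rfl⟩ | ⟨k, hk, rfl⟩
      · rw [Finset.mem_range] at hj
        refine ⟨lam.hookLen i j - 1, ?_, ?_⟩
        · have := hcolN j
          simp only [Finset.mem_range, hookLen, shiftedPart]
          omega
        · have := hcol j hj
          simp only [hookLen]
          omega
      · have h1 := shiftedPart_strictAnti lam N (Finset.mem_Ioi.mp hk)
        refine ⟨shiftedPart lam N i - shiftedPart lam N k - 1, ?_, ?_⟩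
        · rw [Finset.mem_range]
          omega
        · omega
    · rw [Finset.card_image_of_injective _ (fun a b h => by simpa using h),
        Finset.card_union_of_disjoint, Finset.card_image_of_injOn hA,
        Finset.card_image_of_injOn hB, Finset.card_range, Finset.card_range, Fin.card_Ioi,
        shiftedPart]
      · exact hdisj
  · exact hdisj

/-- Compare `prod_hookLen_row` for `lam` and for `∅`, row by row: the interval up to `lam_i + N - 1
- i` exceeds the one up to `N - 1 - i` exactly by the numbers `N - i + j` with `j < lam_i`. -/
theorem prod_hookLen_mul_prod_sub {lam : YoungDiagram} {N : ℕ} (hN : lam.colLen 0 ≤ N)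
    (g : ℕ → M) :
    (∏ c ∈ lam.cells, g (lam.hookLen c.1 c.2)) *
        ∏ i, ∏ k ∈ Finset.Ioi i, g (shiftedPart lam N i - shiftedPart lam N k) =
      (∏ c ∈ lam.cells, g (N - c.1 + c.2)) *
        ∏ i, ∏ k ∈ Finset.Ioi i, g (shiftedPart ⊥ N i - shiftedPart ⊥ N k) := by
  have hrow := fun i => prod_hookLen_row hN i g
  have hbot := fun i => prod_hookLen_row (lam := ⊥) (N := N)
    (by rw [colLen_bot]; exact Nat.zero_le _) i g
  simp only [rowLen_bot, Finset.range_zero, Finset.prod_empty, one_mul] at hbot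
  rw [prod_cells hN fun i j => g (lam.hookLen i j), prod_cells hN fun i j => g (N - i + j),
    Finset.prod_range, Finset.prod_range, ← Finset.prod_mul_distrib, ← Finset.prod_mul_distrib]
  refine Finset.prod_congr rfl fun i _ => ?_
  rw [hrow, hbot, shiftedPart_eq_add, add_comm, Finset.prod_range_add, mul_comm]
  congr 1
  refine Finset.prod_congr rfl fun j _ => ?_
  congr 1
  have := i.2
  rw [shiftedPart_bot]
  omega

/-- Reversing each row exchanges arm lengths and column indices. -/
theorem prod_cells_arm (lam : YoungDiagram) (g : ℕ → M) :
    ∏ c ∈ lam.cells, g (lam.rowLen c.1 - 1 - c.2) = ∏ c ∈ lam.cells, g c.2 := by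
  rw [prod_cells le_rfl fun i j => g (lam.rowLen i - 1 - j), prod_cells le_rfl fun _ j => g j]
  exact Finset.prod_congr rfl fun i _ => Finset.prod_range_reflect _ _

theorem prod_cells_transpose (lam : YoungDiagram) (F : ℕ → ℕ → M) :
    ∏ c ∈ lam.transpose.cells, F c.1 c.2 = ∏ c ∈ lam.cells, F c.2 c.1 := by
  refine Finset.prod_bij' (fun c _ => c.swap) (fun c _ => c.swap) ?_ ?_ ?_ ?_ ?_
  · intro c hc
    rw [mem_cells] at hc ⊢
    exact mem_transpose.mp hc
  · intro c hc
    rw [mem_cells] at hc ⊢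
    rwa [mem_transpose, Prod.swap_swap]
  all_goals simp

theorem prod_cells_leg (lam : YoungDiagram) (g : ℕ → M) :
    ∏ c ∈ lam.cells, g (lam.colLen c.2 - 1 - c.1) = ∏ c ∈ lam.cells, g c.1 := by
  have h1 := prod_cells_arm lam.transpose g
  have h2 := prod_cells_transpose lam fun i j => g (lam.colLen i - 1 - j)
  have h3 := prod_cells_transpose lam fun _ j => g j
  simp only [rowLen_transpose] at h1
  rw [← h2, ← h3, h1]

end Hooks

end YoungDiagram

/-! ### Hook-content formula, framing factor and weight -/

section HookContent

variable {K : Type*} [Field K] {q r : K}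

theorem prod_cells_pow_hookLen (q : K) (lam : YoungDiagram) :
    ∏ c ∈ lam.cells, q ^ lam.hookLen c.1 c.2 = ∏ c ∈ lam.cells, q ^ (c.1 + c.2 + 1) := by
  have h1 : ∀ c ∈ lam.cells, q ^ lam.hookLen c.1 c.2 =
      q ^ (lam.rowLen c.1 - 1 - c.2) * q ^ (lam.colLen c.2 - 1 - c.1) * q := by
    intro c hc
    rw [YoungDiagram.mem_cells] at hc
    have h2 := YoungDiagram.mem_iff_lt_rowLen.mp hc
    have h3 := YoungDiagram.mem_iff_lt_colLen.mp hc
    rw [← pow_add, ← pow_succ, YoungDiagram.hookLen]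
    congr 1
    omega
  rw [Finset.prod_congr rfl h1, Finset.prod_mul_distrib, Finset.prod_mul_distrib,
    lam.prod_cells_arm fun n => q ^ n, lam.prod_cells_leg fun n => q ^ n,
    ← Finset.prod_mul_distrib, ← Finset.prod_mul_distrib]
  refine Finset.prod_congr rfl fun c _ => ?_
  ring

/-- The exponent in the definition is arm minus leg. Over the whole diagram arms are distributed
like column indices and legs like row indices, so contents may replace it. -/
theorem framingFactor_eq (hq0 : q ≠ 0) (lam : YoungDiagram) :
    framingFactor q lam = ∏ c ∈ lam.cells, -(q ^ c.2 / q ^ c.1) := by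
  have h1 : ∀ c ∈ lam.cells,
      (-1) * q ^ ((lam.rowLen c.1 : ℤ) - lam.colLen c.2 + c.1 - c.2) =
      (-1) * (q ^ (lam.rowLen c.1 - 1 - c.2) * (q ^ (lam.colLen c.2 - 1 - c.1))⁻¹) := by
    intro c hc
    rw [YoungDiagram.mem_cells] at hc
    have h2 := YoungDiagram.mem_iff_lt_rowLen.mp hc
    have h3 := YoungDiagram.mem_iff_lt_colLen.mp hc
    rw [← zpow_natCast, ← zpow_natCast, ← zpow_neg, ← zpow_add₀ hq0]
    congr 2
    omega
  rw [framingFactor, Finset.prod_congr rfl h1, Finset.prod_mul_distrib, Finset.prod_mul_distrib,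
    lam.prod_cells_arm fun n => q ^ n, lam.prod_cells_leg fun n => (q ^ n)⁻¹,
    ← Finset.prod_mul_distrib, ← Finset.prod_mul_distrib]
  refine Finset.prod_congr rfl fun c _ => ?_
  rw [div_eq_mul_inv]
  ring

theorem gikvWeight_eq (hq0 : q ≠ 0) (eta : YoungDiagram) :
    gikvWeight q q eta = ∏ c ∈ eta.cells,
      1 / ((1 - q ^ eta.hookLen c.1 c.2) * (1 - (q ^ eta.hookLen c.1 c.2)⁻¹)) := by
  refine Finset.prod_congr rfl fun c hc => ?_
  rw [YoungDiagram.mem_cells] at hc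
  have h2 := YoungDiagram.mem_iff_lt_rowLen.mp hc
  have h3 := YoungDiagram.mem_iff_lt_colLen.mp hc
  rw [← zpow_natCast, ← zpow_neg, ← zpow_add₀ hq0, ← zpow_add₀ hq0, YoungDiagram.hookLen]
  congr 5 <;> omega

theorem hookLen_pos {lam : YoungDiagram} {c : ℕ × ℕ} (hc : c ∈ lam.cells) :
    1 ≤ lam.hookLen c.1 c.2 := by
  rw [YoungDiagram.mem_cells] at hc
  have h2 := YoungDiagram.mem_iff_lt_rowLen.mp hc
  rw [YoungDiagram.hookLen]
  omega

theorem prod_hookLen_ne_zero (hq : ∀ n : ℕ, 1 ≤ n → q ^ n ≠ 1) (lam : YoungDiagram) :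
    ∏ c ∈ lam.cells, (q ^ lam.hookLen c.1 c.2 - 1) ≠ 0 :=
  Finset.prod_ne_zero_iff.mpr fun _ hc => sub_ne_zero.mpr (hq _ (hookLen_pos hc))

/-- The principal alternant in terms of hook lengths and contents. -/
theorem powDet_shiftedPart_hookLen {lam : YoungDiagram} {N : ℕ} (hN : lam.colLen 0 ≤ N) (q : K) :
    powDet q (shiftedPart ⊥ N) (shiftedPart lam N) *
        ∏ c ∈ lam.cells, (q ^ lam.hookLen c.1 c.2 - 1) =
      powDet q (shiftedPart ⊥ N) (shiftedPart ⊥ N) *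
        ∏ c ∈ lam.cells, (q ^ c.1 * (q ^ (N - c.1 + c.2) - 1)) := by
  have hfac : ∀ mu : YoungDiagram, powDet q (shiftedPart ⊥ N) (shiftedPart mu N) =
      (∏ i, ∏ k ∈ Finset.Ioi i, q ^ shiftedPart mu N k) *
        ∏ i, ∏ k ∈ Finset.Ioi i, (q ^ (shiftedPart mu N i - shiftedPart mu N k) - 1) := by
    intro mu
    rw [powDet_shiftedPart_bot]
    simp only [← Finset.prod_mul_distrib]
    refine Finset.prod_congr rfl fun i _ => Finset.prod_congr rfl fun k hk => ?_
    rw [mul_sub, ← pow_add, mul_one,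
      Nat.add_sub_cancel' (shiftedPart_strictAnti mu N (Finset.mem_Ioi.mp hk)).le]
  -- The index `k` is the larger one in exactly `k` pairs, so the powers pulled out of the
  -- Vandermonde factors change by `q ^ (∑ k lam_k)`.
  have hpow : (∏ i : Fin N, ∏ k ∈ Finset.Ioi i, q ^ shiftedPart lam N k) =
      (∏ i : Fin N, ∏ k ∈ Finset.Ioi i, q ^ shiftedPart ⊥ N k) * ∏ c ∈ lam.cells, q ^ c.1 := by
    have hswap : ∀ u : Fin N → K, ∏ i, ∏ k ∈ Finset.Ioi i, u k = ∏ k : Fin N, u k ^ (k : ℕ) := by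
      intro u
      rw [Finset.prod_comm' (t' := Finset.univ) (s' := fun k => Finset.Iio k) (by simp)]
      simp
    rw [hswap, hswap, YoungDiagram.prod_cells hN fun i _ => q ^ i, Finset.prod_range,
      ← Finset.prod_mul_distrib]
    refine Finset.prod_congr rfl fun k _ => ?_
    rw [shiftedPart_eq_add, Finset.prod_const, Finset.card_range]
    ring
  have h := YoungDiagram.prod_hookLen_mul_prod_sub hN fun m => q ^ m - 1
  rw [hfac, hfac, hpow, Finset.prod_mul_distrib]
  linear_combination (∏ i : Fin N, ∏ k ∈ Finset.Ioi i, q ^ shiftedPart ⊥ N k) *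
    (∏ c ∈ lam.cells, q ^ c.1) * h

variable [CharZero K]

/-- The hook-content formula for `s_lam(Q q^ρ, q^{-ρ})`. -/
theorem schurFunction_powerSumMixed_bot_mul (hr : r ^ 2 = q) (hq0 : q ≠ 0)
    (hq : ∀ n : ℕ, 1 ≤ n → q ^ n ≠ 1) (lam : YoungDiagram) :
    schurFunction (powerSumMixed q r ⊥) lam *
        C (∏ c ∈ lam.cells, (q ^ lam.hookLen c.1 c.2 - 1)) =
      C (r ^ lam.card) * ∏ c ∈ lam.cells, (X * C (q ^ c.2) - C (q ^ c.1)) := by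
  apply polynomial_eq_of_eval_pow_eq hq0 hq (lam.colLen 0)
  intro N hN
  refine mul_right_cancel₀ (powDet_shiftedPart_bot_ne_zero hq0 hq
    (shiftedPart_strictAnti ⊥ N).injective) ?_
  have h1 := eval_schurFunction_powerSumMixed hr hq0 hq (lam := ⊥) (N := N)
    (by rw [YoungDiagram.colLen_bot]; omega) hN
  rw [powDet_comm q (shiftedPart lam N)] at h1
  have h2 := powDet_shiftedPart_hookLen hN q
  have h3 : ∏ c ∈ lam.cells, (q ^ c.1 * (q ^ (N - c.1 + c.2) - 1)) =
      ∏ c ∈ lam.cells, (q ^ N * q ^ c.2 - q ^ c.1) := by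
    refine Finset.prod_congr rfl fun c hc => ?_
    have h4 : c.1 ≤ N := by
      rw [YoungDiagram.mem_cells] at hc
      have h5 := YoungDiagram.mem_iff_lt_colLen.mp hc
      have h6 := lam.colLen_anti 0 c.2 (Nat.zero_le _)
      omega
    rw [mul_sub, ← pow_add, ← pow_add, mul_one]
    congr 2
    omega
  rw [h3] at h2
  simp only [eval_mul, eval_C, eval_prod, eval_sub, eval_X]
  linear_combination (∏ c ∈ lam.cells, (q ^ lam.hookLen c.1 c.2 - 1)) * h1 + r ^ lam.card * h2

/-- The principal specialization `s_lam(q^ρ)`. -/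
theorem schurFunction_powerSumRho_bot_mul (hr : r ^ 2 = q) (hq0 : q ≠ 0)
    (hq : ∀ n : ℕ, 1 ≤ n → q ^ n ≠ 1) (lam : YoungDiagram) :
    schurFunction (powerSumRho q r ⊥) lam *
        ∏ c ∈ lam.cells, (q ^ lam.hookLen c.1 c.2 - 1) =
      r ^ lam.card * ∏ c ∈ lam.cells, q ^ c.2 := by
  have h1 := (hasTopCoeff_schurFunction_powerSumMixed q r ⊥ lam).2
  have h2 := congrArg (fun P : K[X] => P.coeff lam.card)
    (schurFunction_powerSumMixed_bot_mul hr hq0 hq lam)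
  have h3 : HasTopCoeff (∏ c ∈ lam.cells, (X * C (q ^ c.2) - C (q ^ c.1)) : K[X])
      (∑ c ∈ lam.cells, 1) (∏ c ∈ lam.cells, q ^ c.2) := by
    apply HasTopCoeff.prod
    intro c _
    constructor
    · rw [mul_comm, sub_eq_add_neg, ← C_neg]
      exact natDegree_linear_le
    · rw [coeff_sub, coeff_mul_C, coeff_X_one, coeff_C_of_ne_zero one_ne_zero, one_mul, sub_zero]
  rw [Finset.sum_const, smul_eq_mul, mul_one] at h3
  rw [coeff_mul_C, coeff_C_mul, h1] at h2
  rw [h2]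
  congr 1
  exact h3.2

theorem schurFunction_powerSumRho_bot_ne_zero (hr : r ^ 2 = q) (hq0 : q ≠ 0)
    (hq : ∀ n : ℕ, 1 ≤ n → q ^ n ≠ 1) (lam : YoungDiagram) :
    schurFunction (powerSumRho q r ⊥) lam ≠ 0 := by
  have h := schurFunction_powerSumRho_bot_mul hr hq0 hq lam
  intro h0
  rw [h0, zero_mul] at h
  exact mul_ne_zero (pow_ne_zero _ (ne_zero_of_sq_eq hr hq0))
    (Finset.prod_ne_zero_iff.mpr fun c _ => pow_ne_zero _ hq0) h.symm

/-- The framing factor is what turns each hook-content factor `Q q^j - q^i` into `q^j (1 - q^{j-i}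
Q)`; the remaining powers and hooks are `s_lam(q^ρ)`. In this form the polynomial can be matched
with a quotient of Cauchy products. -/
theorem framingFactor_mul_schurFunction (hr : r ^ 2 = q) (hq0 : q ≠ 0)
    (hq : ∀ n : ℕ, 1 ≤ n → q ^ n ≠ 1) (lam : YoungDiagram) :
    C (framingFactor q lam) * schurFunction (powerSumMixed q r ⊥) lam =
      C (schurFunction (powerSumRho q r ⊥) lam) *
        ∏ c ∈ lam.cells, (1 - C (q ^ c.2 / q ^ c.1) * X) := by
  have hH := prod_hookLen_ne_zero hq lam
  have h1 := schurFunction_powerSumMixed_bot_mul hr hq0 hq lam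
  have h2 := congrArg C (schurFunction_powerSumRho_bot_mul hr hq0 hq lam)
  have h3 : C (framingFactor q lam) * ∏ c ∈ lam.cells, (X * C (q ^ c.2) - C (q ^ c.1)) =
      C (∏ c ∈ lam.cells, q ^ c.2) * ∏ c ∈ lam.cells, (1 - C (q ^ c.2 / q ^ c.1) * X) := by
    rw [framingFactor_eq hq0, map_prod, map_prod, ← Finset.prod_mul_distrib,
      ← Finset.prod_mul_distrib]
    refine Finset.prod_congr rfl fun c _ => ?_
    have h4 : C (q ^ c.2 / q ^ c.1) * C (q ^ c.1) = C (q ^ c.2) := by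
      rw [← C_mul, div_mul_cancel₀ _ (pow_ne_zero _ hq0)]
    rw [C_neg]
    linear_combination h4
  refine mul_right_cancel₀ (C_ne_zero.mpr hH) ?_
  rw [C_mul, C_mul] at h2
  linear_combination C (framingFactor q lam) * h1 + C (r ^ lam.card) * h3 -
    (∏ c ∈ lam.cells, (1 - C (q ^ c.2 / q ^ c.1) * X)) * h2

/-- The weight of `eta` is `s_eta(q^ρ) s_eta(q^{-ρ})`. -/
theorem gikvWeight_eq_schurFunction_mul (hr : r ^ 2 = q) (hq0 : q ≠ 0)
    (hq : ∀ n : ℕ, 1 ≤ n → q ^ n ≠ 1) (eta : YoungDiagram) :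
    gikvWeight q (r ^ 2) eta = schurFunction (powerSumRho q r ⊥) eta *
      schurFunction (powerSumNegRho r) eta := by
  have hH := prod_hookLen_ne_zero hq eta
  -- The value at `q^{-ρ}` is the constant coefficient in the hook-content formula; the value at
  -- `q^ρ` is its top coefficient.
  have h1 := congrArg (fun P : K[X] => P.coeff 0)
    (schurFunction_powerSumMixed_bot_mul hr hq0 hq eta)
  rw [coeff_mul_C, coeff_C_mul, coeff_zero_schurFunction_powerSumMixed, coeff_zero_prod] at h1
  simp only [coeff_sub, coeff_mul_C, coeff_X_zero, zero_mul, coeff_C_zero, zero_sub] at h1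
  have h2 := schurFunction_powerSumRho_bot_mul hr hq0 hq eta
  rw [hr, gikvWeight_eq hq0]
  have h3 : (∏ c ∈ eta.cells,
      1 / ((1 - q ^ eta.hookLen c.1 c.2) * (1 - (q ^ eta.hookLen c.1 c.2)⁻¹))) *
      ((∏ c ∈ eta.cells, (q ^ eta.hookLen c.1 c.2 - 1)) *
        ∏ c ∈ eta.cells, (q ^ eta.hookLen c.1 c.2 - 1)) =
      ∏ c ∈ eta.cells, -q ^ eta.hookLen c.1 c.2 := by
    rw [← Finset.prod_mul_distrib, ← Finset.prod_mul_distrib]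
    refine Finset.prod_congr rfl fun c hc => ?_
    have h4 : q ^ eta.hookLen c.1 c.2 - 1 ≠ 0 := sub_ne_zero.mpr (hq _ (hookLen_pos hc))
    have h5 : q ^ eta.hookLen c.1 c.2 ≠ 0 := pow_ne_zero _ hq0
    have h6 : (1 - q ^ eta.hookLen c.1 c.2) * (1 - (q ^ eta.hookLen c.1 c.2)⁻¹) =
        -((q ^ eta.hookLen c.1 c.2 - 1) * (q ^ eta.hookLen c.1 c.2 - 1)) /
          q ^ eta.hookLen c.1 c.2 := by
      field_simp
      ring
    rw [h6]
    field_simp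
  have h7 : ∏ c ∈ eta.cells, -q ^ eta.hookLen c.1 c.2 =
      (r ^ eta.card * ∏ c ∈ eta.cells, q ^ c.2) * (r ^ eta.card * ∏ c ∈ eta.cells, -q ^ c.1) := by
    have h8 : ∀ u : ℕ × ℕ → K, ∏ c ∈ eta.cells, -u c =
        (∏ c ∈ eta.cells, (-1)) * ∏ c ∈ eta.cells, u c := by
      intro u
      rw [← Finset.prod_mul_distrib]
      exact Finset.prod_congr rfl fun c _ => by ring
    have h9 : r ^ eta.card * r ^ eta.card = ∏ c ∈ eta.cells, q := by
      rw [Finset.prod_const, ← hr, ← pow_mul, ← pow_add]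
      congr 1
      rw [YoungDiagram.card]
      ring
    have h10 : ∏ c ∈ eta.cells, q ^ (c.1 + c.2 + 1) =
        (∏ c ∈ eta.cells, q ^ c.1) * (∏ c ∈ eta.cells, q ^ c.2) * ∏ c ∈ eta.cells, q := by
      rw [← Finset.prod_mul_distrib, ← Finset.prod_mul_distrib]
      exact Finset.prod_congr rfl fun c _ => by ring
    rw [h8, prod_cells_pow_hookLen, h8 fun c => q ^ c.1, h10, ← h9]
    ring
  refine mul_right_cancel₀ (mul_ne_zero hH hH) ?_
  rw [h3, h7, ← h2, ← h1]
  ring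

end HookContent

/-! ### The Cauchy identity -/

section Cauchy

variable {A : Type*} [CommRing A]

theorem StrictAnti.add_le_nat {N : ℕ} {a : Fin N → ℕ} (ha : StrictAnti a) :
    ∀ (d : ℕ) (i j : Fin N), (j : ℕ) = i + d → a j + d ≤ a i := by
  intro d
  induction d with
  | zero =>
    intro i j h
    have : j = i := Fin.ext h
    rw [this, add_zero]
  | succ d ih =>
    intro i j h
    have hj := j.2
    have h1 := ih i ⟨i + d, by omega⟩ rfl
    have h2 : a j < a ⟨i + d, by omega⟩ := ha (by rw [Fin.lt_def]; simp only; omega)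
    omega

theorem exists_shiftedPart_eq {N : ℕ} {a : Fin N → ℕ} (ha : StrictAnti a) :
    ∃ lam : YoungDiagram, lam.colLen 0 ≤ N ∧ shiftedPart lam N = a := by
  have hle : ∀ i : Fin N, N - 1 - i ≤ a i := by
    intro i
    have hi := i.2
    have := ha.add_le_nat (N - 1 - i) i ⟨N - 1, by omega⟩ (by simp only; omega)
    omega
  obtain ⟨lam, h1, h2⟩ := YoungDiagram.exists_rowLen_eq (fun i => a i - (N - 1 - i)) (by
    intro i j hij
    have hi := i.2
    have hj := j.2
    have h0 : (i : ℕ) ≤ j := hij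
    have h1 := ha.add_le_nat (j - i) i j (by omega)
    have h2 := hle i
    have h3 := hle j
    dsimp only
    omega)
  refine ⟨lam, h1, ?_⟩
  ext i
  have := hle i
  rw [shiftedPart, h2]
  omega

theorem eq_of_shiftedPart_eq {N : ℕ} {lam mu : YoungDiagram} (hlam : lam.colLen 0 ≤ N)
    (hmu : mu.colLen 0 ≤ N) (h : shiftedPart lam N = shiftedPart mu N) : lam = mu := by
  apply YoungDiagram.ext_rowLen
  intro i
  rcases lt_or_ge i N with hi | hi
  · have h1 := congrFun h ⟨i, hi⟩
    simpa [shiftedPart] using h1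
  · rw [YoungDiagram.rowLen_eq_zero_of_colLen_le (hlam.trans hi),
      YoungDiagram.rowLen_eq_zero_of_colLen_le (hmu.trans hi)]

theorem coeff_prod_mk {N : ℕ} (F : Fin N → ℕ → A) (k : ℕ) :
    PowerSeries.coeff k (∏ j, PowerSeries.mk (F j)) =
      ∑ m ∈ Finset.piAntidiag Finset.univ k, ∏ j, F j (m j) := by
  rw [PowerSeries.coeff_prod]
  refine Finset.sum_bij' (fun l _ => ⇑l) (fun m _ => Finsupp.equivFunOnFinite.symm m)
    ?_ ?_ ?_ ?_ ?_
  · intro l hl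
    rw [Finset.mem_finsuppAntidiag] at hl
    rw [Finset.mem_piAntidiag]
    exact ⟨hl.1, by simp⟩
  · intro m hm
    rw [Finset.mem_piAntidiag] at hm
    rw [Finset.mem_finsuppAntidiag]
    exact ⟨hm.1, by simp⟩
  · intro l _
    ext
    simp
  · intro m _
    simp
  · intro l _
    simp

/-- Antisymmetrizing a symmetric product against the Vandermonde determinant. -/
theorem coeff_prod_mul_alternant {N : ℕ} (x : Fin N → A) (h : ℕ → A) (k : ℕ) :
    PowerSeries.coeff k (∏ j, PowerSeries.mk fun n => x j ^ n * h n) *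
        (Matrix.of fun i k : Fin N => x k ^ (N - 1 - i)).det =
      ∑ m ∈ Finset.piAntidiag Finset.univ k, (∏ j, h (m j)) *
        (Matrix.of fun i k : Fin N => x k ^ (m i + (N - 1 - i))).det := by
  rw [coeff_prod_mk]
  simp only [Matrix.det_apply', Matrix.of_apply, Finset.mul_sum]
  conv_rhs => rw [Finset.sum_comm]
  refine Finset.sum_congr rfl fun σ _ => ?_
  rw [Finset.sum_mul]
  refine Finset.sum_bij' (fun m _ => m ∘ σ.symm) (fun m _ => m ∘ σ) ?_ ?_ ?_ ?_ ?_
  · intro m hm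
    rw [Finset.mem_piAntidiag] at hm ⊢
    refine ⟨?_, by simp⟩
    rw [← hm.1]
    exact Equiv.sum_comp σ.symm m
  · intro m hm
    rw [Finset.mem_piAntidiag] at hm ⊢
    refine ⟨?_, by simp⟩
    rw [← hm.1]
    exact Equiv.sum_comp σ m
  · intro m _
    ext
    simp
  · intro m _
    ext
    simp
  · intro m _
    have h1 : ∏ j, h ((m ∘ σ.symm) j) = ∏ j, h (m j) := Equiv.prod_comp σ.symm fun j => h (m j)
    rw [h1]
    simp only [Function.comp_apply, Equiv.symm_apply_apply, pow_add, Finset.prod_mul_distrib]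
    ring

theorem injective_of_det_pow_ne_zero {N : ℕ} {x : Fin N → A} {b : Fin N → ℕ}
    (h : (Matrix.of fun i k : Fin N => x k ^ b i).det ≠ 0) : Function.Injective b := by
  intro i j hij
  by_contra hne
  apply h
  apply Matrix.det_zero_of_row_eq hne
  ext k
  simp [hij]

variable [Algebra ℚ A]

theorem completeHomogeneousSub_eq_of_add_eq (p : ℕ → A) {a b a' b' : ℕ}
    (h : a + b' = a' + b) : completeHomogeneousSub p a b = completeHomogeneousSub p a' b' := by
  rw [completeHomogeneousSub, completeHomogeneousSub]
  by_cases hb : b ≤ a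
  · rw [if_pos hb, if_pos (by omega)]
    congr 1
    omega
  · rw [if_neg hb, if_neg (by omega)]

theorem schurFunction_eq_det_shiftedPart (p : ℕ → A) {lam : YoungDiagram} {N : ℕ}
    (hN : lam.colLen 0 ≤ N) :
    schurFunction p lam = (Matrix.of fun i j : Fin N =>
      completeHomogeneousSub p (shiftedPart lam N i) (shiftedPart ⊥ N j)).det := by
  rw [schurFunction_eq_det p hN]
  congr 1
  ext i j
  have hi := i.2
  have hj := j.2
  apply completeHomogeneousSub_eq_of_add_eq
  rw [shiftedPart_bot, shiftedPart]
  omega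

/-- The Cauchy identity, one side in finitely many variables: the alternants of these variables
paired with Schur functions at arbitrary power sums. -/
theorem sum_det_mul_schurFunction {N k : ℕ} (hk : k ≤ N) (x : Fin N → A) (p : ℕ → A) :
    ∑ eta ∈ (finite_setOf_card_eq k).toFinset,
        (Matrix.of fun i k : Fin N => x k ^ shiftedPart eta N i).det * schurFunction p eta =
      PowerSeries.coeff k (∏ j, PowerSeries.mk fun n => x j ^ n * completeHomogeneous p n) *
        (Matrix.of fun i k : Fin N => x k ^ (N - 1 - i)).det := by
  classical
  rw [coeff_prod_mul_alternant]
  set d : ℕ := ∑ i, shiftedPart ⊥ N i with hd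
  set c : (Fin N → ℕ) → A := fun b => ∏ i, completeHomogeneousSub p (b i) (shiftedPart ⊥ N i)
    with hc
  set D : (Fin N → ℕ) → A := fun b => (Matrix.of fun i k : Fin N => x k ^ b i).det with hD
  have hlen : ∀ eta ∈ (finite_setOf_card_eq k).toFinset, eta.colLen 0 ≤ N := by
    intro eta heta
    have h1 : eta.card = k := by simpa using heta
    exact (eta.colLen_zero_le_card.trans h1.le).trans hk
  -- Substitute `b = m + δ`, where `δ` is the shifted empty partition. The sum extends to all `b` of
  -- total `k + d`, since `h` with a negative index is zero.
  have h1 : ∑ m ∈ Finset.piAntidiag Finset.univ k, (∏ j, completeHomogeneous p (m j)) *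
        (Matrix.of fun i k : Fin N => x k ^ (m i + (N - 1 - i))).det =
      ∑ b ∈ Finset.piAntidiag Finset.univ (k + d), c b * D b := by
    rw [← Finset.sum_subset (f := fun b => c b * D b) (s₁ := (Finset.piAntidiag Finset.univ k).map
      (addRightEmbedding (shiftedPart ⊥ N)))]
    · rw [Finset.sum_map]
      refine Finset.sum_congr rfl fun m _ => ?_
      simp only [addRightEmbedding_apply, hc, hD, Pi.add_apply]
      congr 1
      · refine Finset.prod_congr rfl fun j _ => ?_
        rw [completeHomogeneousSub, if_pos (Nat.le_add_left _ _), Nat.add_sub_cancel]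
      · simp only [shiftedPart_bot]
    · intro b hb
      rw [Finset.mem_map] at hb
      obtain ⟨m, hm, rfl⟩ := hb
      rw [Finset.mem_piAntidiag] at hm ⊢
      refine ⟨?_, by simp⟩
      simp only [addRightEmbedding_apply, Pi.add_apply, Finset.sum_add_distrib]
      rw [hm.1]
    · intro b hb hb'
      rw [Finset.mem_piAntidiag] at hb
      have h2 : ∃ i, b i < shiftedPart ⊥ N i := by
        by_contra hcon
        push Not at hcon
        apply hb'
        rw [Finset.mem_map]
        refine ⟨fun i => b i - shiftedPart ⊥ N i, ?_, ?_⟩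
        · rw [Finset.mem_piAntidiag]
          refine ⟨?_, by simp⟩
          have h3 : ∑ i, (b i - shiftedPart ⊥ N i) + d = ∑ i, b i := by
            rw [hd, ← Finset.sum_add_distrib]
            exact Finset.sum_congr rfl fun i _ => Nat.sub_add_cancel (hcon i)
          have h4 : ∑ i, b i = k + d := hb.1
          omega
        · ext i
          exact Nat.sub_add_cancel (hcon i)
      obtain ⟨i, hi⟩ := h2
      have h3 : c b = 0 := by
        apply Finset.prod_eq_zero (Finset.mem_univ i)
        rw [completeHomogeneousSub, if_neg (by omega)]
      rw [h3, zero_mul]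
  -- Exponents with a repetition give a vanishing alternant. The remaining `b` are, each once,
  -- permutations of the shifted parts of some `eta` with `|eta| = k`, and the sum over these
  -- permutations is the Jacobi–Trudi determinant of `eta`. The bound `k ≤ N` ensures that no `eta`
  -- is too long.
  rw [h1, ← Finset.sum_filter_of_ne (p := Function.Injective)
    fun b _ hb => injective_of_det_pow_ne_zero (right_ne_zero_of_mul hb)]
  have h2 : ∀ eta ∈ (finite_setOf_card_eq k).toFinset,
      (Matrix.of fun i k : Fin N => x k ^ shiftedPart eta N i).det * schurFunction p eta =
      ∑ σ : Equiv.Perm (Fin N), c (shiftedPart eta N ∘ σ) * D (shiftedPart eta N ∘ σ) := by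
    intro eta heta
    rw [schurFunction_eq_det_shiftedPart p (hlen eta heta), Matrix.det_apply' (Matrix.of fun i j =>
      completeHomogeneousSub p (shiftedPart eta N i) (shiftedPart ⊥ N j)), Finset.mul_sum]
    refine Finset.sum_congr rfl fun σ _ => ?_
    have h3 : D (shiftedPart eta N ∘ σ) = (Equiv.Perm.sign σ : ℤ) *
        (Matrix.of fun i k : Fin N => x k ^ shiftedPart eta N i).det := by
      rw [← Matrix.det_permute]
      rfl
    rw [h3]
    simp only [hc, Matrix.of_apply, Function.comp_apply]
    ring
  rw [Finset.sum_congr rfl h2, ← Finset.sum_product']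
  refine Finset.sum_bij (fun y _ => shiftedPart y.1 N ∘ y.2) ?_ ?_ ?_ ?_
  · rintro ⟨eta, σ⟩ hy
    rw [Finset.mem_product] at hy
    have hcard : eta.card = k := by simpa using hy.1
    rw [Finset.mem_filter, Finset.mem_piAntidiag]
    refine ⟨⟨?_, by simp⟩, (shiftedPart_strictAnti eta N).injective.comp σ.injective⟩
    have h3 := sum_shiftedPart (hlen eta hy.1)
    rw [hcard] at h3
    rw [← h3]
    exact Equiv.sum_comp σ (shiftedPart eta N)
  · rintro ⟨eta, σ⟩ hy ⟨zeta, τ⟩ hz h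
    rw [Finset.mem_product] at hy hz
    dsimp only at h
    have h3 : shiftedPart eta N = shiftedPart zeta N := by
      rw [← (shiftedPart_strictAnti eta N).range_inj (shiftedPart_strictAnti zeta N),
        ← σ.surjective.range_comp, h, τ.surjective.range_comp]
    have h4 := eq_of_shiftedPart_eq (hlen eta hy.1) (hlen zeta hz.1) h3
    subst h4
    congr 1
    ext i
    have h5 := (shiftedPart_strictAnti eta N).injective (congrFun h i)
    rw [h5]
  · intro b hb
    rw [Finset.mem_filter, Finset.mem_piAntidiag] at hb
    obtain ⟨⟨hsum, -⟩, hinj⟩ := hb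
    change ∑ i, b i = k + d at hsum
    set τ : Equiv.Perm (Fin N) := Fin.revPerm.trans (Tuple.sort b) with hτ
    have hanti : StrictAnti (b ∘ τ) := by
      have h3 : Antitone (b ∘ τ) := by
        intro i j hij
        exact Tuple.monotone_sort b (Fin.rev_le_rev.mpr hij)
      exact h3.strictAnti_of_injective (hinj.comp τ.injective)
    obtain ⟨lam, hlam, hlamb⟩ := exists_shiftedPart_eq hanti
    refine ⟨(lam, τ.symm), ?_, ?_⟩
    · rw [Finset.mem_product]
      refine ⟨?_, Finset.mem_univ _⟩
      have h3 := sum_shiftedPart hlam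
      rw [hlamb] at h3
      have h4 : ∑ i, (b ∘ τ) i = ∑ i, b i := Equiv.sum_comp τ b
      have h5 : lam.card = k := by omega
      simpa using h5
    · dsimp only
      rw [hlamb]
      ext i
      simp
  · intro y _
    rfl

/-- The Cauchy identity `∑ s_eta(x) s_eta(p) = h_k(x p)`, the sum over `|eta| = k`. -/
theorem sum_schurFunction_mul_schurFunction [IsDomain A] {N k : ℕ} (hk : k ≤ N) (x : Fin N → A)
    (hx : (Matrix.of fun i k : Fin N => x k ^ (N - 1 - i)).det ≠ 0) (p : ℕ → A) :
    ∑ eta ∈ (finite_setOf_card_eq k).toFinset,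
        schurFunction (fun n => ∑ i, x i ^ n) eta * schurFunction p eta =
      completeHomogeneous (fun n => (∑ i, x i ^ n) * p n) k := by
  refine mul_right_cancel₀ hx ?_
  have h1 : completeHomogeneous (fun n => (∑ i, x i ^ n) * p n) k =
      PowerSeries.coeff k (∏ j, PowerSeries.mk fun n => x j ^ n * completeHomogeneous p n) := by
    rw [← PowerSeries.coeff_mk k (completeHomogeneous fun n => (∑ i, x i ^ n) * p n)]
    simp only [Finset.sum_mul, mk_completeHomogeneous_sum]
    congr 1
    refine Finset.prod_congr rfl fun j _ => ?_
    ext n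
    rw [PowerSeries.coeff_mk, PowerSeries.coeff_mk, completeHomogeneous_pow_mul]
  rw [h1, ← sum_det_mul_schurFunction hk, Finset.sum_mul]
  refine Finset.sum_congr rfl fun eta heta => ?_
  have h2 : eta.card = k := by simpa using heta
  have h3 := schurFunction_mul_alternant eta ((eta.colLen_zero_le_card.trans h2.le).trans hk) x
  rw [mul_right_comm, h3]
  rfl

end Cauchy

/-! ### The partition function with one empty index -/

section PartitionFunction

variable {K : Type*} [Field K] [CharZero K] {q r : K}

/-- The Cauchy identity at `q^lam q^ρ`. -/
theorem sum_schurFunction_powerSumRho_mul (hr : r ^ 2 = q) (hq0 : q ≠ 0)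
    (hq : ∀ n : ℕ, 1 ≤ n → q ^ n ≠ 1) (lam : YoungDiagram) (p : ℕ → K) (k : ℕ) :
    ∑ eta ∈ (finite_setOf_card_eq k).toFinset,
        schurFunction (powerSumRho q r lam) eta * schurFunction p eta =
      completeHomogeneous (fun n => powerSumRho q r lam n * p n) k := by
  have hr0 := ne_zero_of_sq_eq hr hq0
  -- The identity is lifted to the mixed power sums, where it can be tested at `Q = q^N` in `N ≥ k`
  -- variables. The claim is then its coefficient of degree `k`.
  have h1 : ∑ eta ∈ (finite_setOf_card_eq k).toFinset,
        schurFunction (powerSumMixed q r lam) eta * C (schurFunction p eta) =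
      completeHomogeneous (fun n => powerSumMixed q r lam n * C (p n)) k := by
    apply polynomial_eq_of_eval_pow_eq hq0 hq (max k (lam.colLen 0))
    intro N hN
    have hk := (le_max_left _ _).trans hN
    have hlam := (le_max_right _ _).trans hN
    have hx : (Matrix.of fun i k : Fin N =>
        (r * q ^ shiftedPart lam N k) ^ (N - 1 - (i : ℕ))).det ≠ 0 := by
      have h2 := det_mul_pow r q (shiftedPart ⊥ N) (shiftedPart lam N)
      simp only [shiftedPart_bot] at h2
      rw [h2]
      exact mul_ne_zero (pow_ne_zero _ hr0) (powDet_shiftedPart_bot_ne_zero hq0 hq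
        (shiftedPart_strictAnti lam N).injective)
    have h2 := sum_schurFunction_mul_schurFunction hk
      (fun i => r * q ^ shiftedPart lam N i) hx p
    have h3 := map_completeHomogeneous (evalRingHom (q ^ N))
      (fun n => powerSumMixed q r lam n * C (p n)) k
    rw [coe_evalRingHom] at h3
    rw [h3, eval_finsetSum]
    simp only [eval_mul, eval_C]
    rw [completeHomogeneous_congr (p' := fun n =>
      (∑ i, (r * q ^ shiftedPart lam N i) ^ n) * p n)
      fun n hn => by rw [eval_powerSumMixed hr hq0 hq hlam hn], ← h2]
    refine Finset.sum_congr rfl fun eta _ => ?_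
    have h4 := map_schurFunction (evalRingHom (q ^ N)) (powerSumMixed q r lam) eta
    rw [coe_evalRingHom] at h4
    rw [h4, schurFunction_congr fun n hn => eval_powerSumMixed hr hq0 hq hlam hn]
  have h2 : HasTopCoeff (∑ eta ∈ (finite_setOf_card_eq k).toFinset,
      schurFunction (powerSumMixed q r lam) eta * C (schurFunction p eta)) k
      (∑ eta ∈ (finite_setOf_card_eq k).toFinset,
        schurFunction (powerSumRho q r lam) eta * schurFunction p eta) := by
    apply HasTopCoeff.sum
    intro eta heta
    have h3 : eta.card = k := by simpa using heta
    have h4 := (hasTopCoeff_schurFunction_powerSumMixed q r lam eta).mul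
      (show HasTopCoeff (C (schurFunction p eta)) 0 (schurFunction p eta) from ⟨by simp, by simp⟩)
    rwa [h3] at h4
  have h3 : HasTopCoeff (completeHomogeneous (fun n => powerSumMixed q r lam n * C (p n)) k) k
      (completeHomogeneous (fun n => powerSumRho q r lam n * p n) k) := by
    apply hasTopCoeff_completeHomogeneous
    intro n hn
    exact (hasTopCoeff_powerSumMixed q r lam hn).mul
      (show HasTopCoeff (C (p n)) 0 (p n) from ⟨by simp, by simp⟩)
  rw [← h2.2, h1, h3.2]

/-- In each row `q^{n lam_i} - 1` divided by `q^{n/2} - q^{-n/2}` is a finite geometric sum. So the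
product alphabet of `lam` is that of `∅` with one variable `q^{j-i}` removed for every cell. -/
theorem powerSumRho_mul_powerSumNegRho (hr : r ^ 2 = q) (hq0 : q ≠ 0)
    (hq : ∀ n : ℕ, 1 ≤ n → q ^ n ≠ 1) (lam : YoungDiagram) {n : ℕ} (hn : 1 ≤ n) :
    powerSumRho q r lam n * powerSumNegRho r n =
      powerSumRho q r ⊥ n * powerSumNegRho r n +
        ∑ c ∈ lam.cells, -(q ^ c.2 / q ^ c.1) ^ n := by
  have hr0 := ne_zero_of_sq_eq hr hq0
  have hu0 : r ^ n ≠ 0 := pow_ne_zero _ hr0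
  have hu := pow_sub_inv_pow_ne_zero hr hq0 hq hn
  have hqn : q ^ n = (r ^ n) ^ 2 := by rw [← hr, ← pow_mul, ← pow_mul, mul_comm]
  have h1 : powerSumRho q r ⊥ n = 1 / (r ^ n - r⁻¹ ^ n) := by
    rw [powerSumRho, YoungDiagram.colLen_bot]
    simp
  rw [YoungDiagram.sum_cells le_rfl fun i j => -(q ^ j / q ^ i) ^ n, powerSumRho, h1,
    powerSumNegRho, add_mul, add_comm, add_right_inj, Finset.sum_mul]
  refine Finset.sum_congr rfl fun i _ => ?_
  have h2 : ∀ m, q ^ (n * m) = ((r ^ n) ^ 2) ^ m := fun m => by rw [pow_mul, hqn]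
  have h3 : ∀ j : ℕ, (q ^ j / q ^ i) ^ n = ((r ^ n) ^ 2) ^ j * ((r ^ n)⁻¹ ^ 2) ^ i := by
    intro j
    rw [div_pow, ← pow_mul, ← pow_mul, mul_comm j, mul_comm i, h2, h2, div_eq_mul_inv, inv_pow,
      inv_pow]
  simp only [h2, h3]
  rw [inv_pow] at hu ⊢
  rw [pow_mul, inv_pow]
  generalize r ^ n = u at *
  have h7 : (u ^ (2 * i + 1))⁻¹ = (u⁻¹ ^ 2) ^ i * u⁻¹ := by
    rw [pow_succ, mul_inv, pow_mul, ← inv_pow, ← inv_pow]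
  rw [Finset.sum_neg_distrib, ← Finset.sum_mul, h7]
  have h4 := mul_geom_sum (u ^ 2) (lam.rowLen i)
  rw [← h4]
  have h5 : (u ^ 2 - 1) * u⁻¹ * (1 / (u - u⁻¹)) = 1 := by
    have h6 : u ^ 2 - 1 = (u - u⁻¹) * u := by
      rw [sub_mul, inv_mul_cancel₀ hu0]
      ring
    rw [h6]
    have h7 : u * u⁻¹ = 1 := mul_inv_cancel₀ hu0
    have h8 : (u - u⁻¹) * (1 / (u - u⁻¹)) = 1 := by rw [mul_one_div, div_self hu]
    linear_combination (u - u⁻¹) * (1 / (u - u⁻¹)) * h7 + h8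
  linear_combination (-(∑ j ∈ Finset.range (lam.rowLen i), (u ^ 2) ^ j) * (u⁻¹ ^ 2) ^ i) * h5

/-- The factor `s_eta(q^ρ)` of the weight allows the symmetry to move `eta` out of the argument of
`s_lam`; the sum over `eta` is then a Cauchy sum. -/
theorem gikvZ_bot_right (hr : r ^ 2 = q) (hq0 : q ≠ 0) (hq : ∀ n : ℕ, 1 ≤ n → q ^ n ≠ 1)
    (lam : YoungDiagram) :
    gikvZ q r lam ⊥ = PowerSeries.C (schurFunction (powerSumRho q r ⊥) lam) *
      PowerSeries.mk (completeHomogeneous fun n =>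
        powerSumRho q r lam n * powerSumNegRho r n) := by
  ext k
  rw [gikvZ, PowerSeries.coeff_mk, PowerSeries.coeff_C_mul, PowerSeries.coeff_mk,
    ← sum_schurFunction_powerSumRho_mul hr hq0 hq, Finset.mul_sum]
  refine Finset.sum_congr rfl fun eta _ => ?_
  rw [schurFunction_bot, gikvWeight_eq_schurFunction_mul hr hq0 hq]
  linear_combination (-schurFunction (powerSumNegRho r) eta) *
    schurFunction_powerSumRho_mul_comm hr hq0 hq lam eta

/-- The case `mu = ∅` of the theorem. -/
theorem gikvZ_bot_right_eq_mul (hr : r ^ 2 = q) (hq0 : q ≠ 0)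
    (hq : ∀ n : ℕ, 1 ≤ n → q ^ n ≠ 1) (lam : YoungDiagram) :
    gikvZ q r lam ⊥ = gikvZ q r ⊥ ⊥ *
      ((C (framingFactor q lam) * schurFunction (powerSumMixed q r ⊥) lam : K[X]) :
        PowerSeries K) := by
  rw [gikvZ_bot_right hr hq0 hq, gikvZ_bot_right hr hq0 hq, schurFunction_bot,
    framingFactor_mul_schurFunction hr hq0 hq]
  have h1 : PowerSeries.mk (completeHomogeneous fun n =>
        powerSumRho q r lam n * powerSumNegRho r n) =
      PowerSeries.mk (completeHomogeneous fun n =>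
        powerSumRho q r ⊥ n * powerSumNegRho r n) *
      ∏ c ∈ lam.cells, (1 - PowerSeries.C (q ^ c.2 / q ^ c.1) * PowerSeries.X) := by
    rw [show completeHomogeneous (fun n => powerSumRho q r lam n * powerSumNegRho r n) =
      completeHomogeneous (fun n => powerSumRho q r ⊥ n * powerSumNegRho r n +
        ∑ c ∈ lam.cells, -(q ^ c.2 / q ^ c.1) ^ n) from funext fun k =>
          completeHomogeneous_congr
            (fun n hn => powerSumRho_mul_powerSumNegRho hr hq0 hq lam hn) k,
      mk_completeHomogeneous_add, mk_completeHomogeneous_sum]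
    simp only [mk_completeHomogeneous_neg_pow_mul]
  have h2 : ((∏ c ∈ lam.cells, (1 - C (q ^ c.2 / q ^ c.1) * X) : K[X]) : PowerSeries K) =
      ∏ c ∈ lam.cells, (1 - PowerSeries.C (q ^ c.2 / q ^ c.1) * PowerSeries.X) := by
    rw [← Polynomial.coeToPowerSeries.ringHom_apply, map_prod]
    simp
  rw [h1, Polynomial.coe_mul, Polynomial.coe_C, h2, map_one]
  ring

theorem constantCoeff_gikvZ_bot (q r : K) :
    PowerSeries.constantCoeff (gikvZ q r ⊥ ⊥) = 1 := by
  rw [gikvZ, ← PowerSeries.coeff_zero_eq_constantCoeff_apply, PowerSeries.coeff_mk]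
  have h : (finite_setOf_card_eq 0).toFinset = {⊥} := by
    ext eta
    simp only [Set.Finite.mem_toFinset, Set.mem_ofPred_eq, Finset.mem_singleton]
    constructor
    · intro h
      rw [YoungDiagram.card, Finset.card_eq_zero] at h
      exact YoungDiagram.ext h
    · rintro rfl
      exact YoungDiagram.card_bot
  rw [h, Finset.sum_singleton, schurFunction_bot]
  simp [gikvWeight]

end PartitionFunction

/-! ### Moment functionals on symmetric functions -/

section MomentFunctional

variable {K : Type*} [Field K]

/-- The linear functional on polynomials in `N` variables with independent variables and
moments `g`. -/
def momentFunctional (g : ℕ → K) (N : ℕ) : MvPolynomial (Fin N) K →ₗ[K] K :=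
  (MvPolynomial.basisMonomials (Fin N) K).constr K fun m => ∏ i, g (m i)

/-- The alternant with exponents `b` in the polynomial ring. -/
def alternant (K : Type*) [Field K] {N : ℕ} (b : Fin N → ℕ) : MvPolynomial (Fin N) K :=
  (Matrix.of fun i k : Fin N => MvPolynomial.X k ^ b i).det

theorem momentFunctional_monomial (g : ℕ → K) {N : ℕ} (m : Fin N →₀ ℕ) :
    momentFunctional g N (MvPolynomial.monomial m 1) = ∏ i, g (m i) := by
  rw [momentFunctional, ← congrFun (MvPolynomial.coe_basisMonomials (Fin N) K) m,
    Module.Basis.constr_basis]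

theorem momentFunctional_prod_X_pow (g : ℕ → K) {N : ℕ} (b : Fin N → ℕ) :
    momentFunctional g N (∏ k, MvPolynomial.X k ^ b k) = ∏ k, g (b k) := by
  have h : ∏ k, MvPolynomial.X k ^ b k =
      MvPolynomial.monomial (Finsupp.equivFunOnFinite.symm b) (1 : K) := by
    rw [MvPolynomial.monomial_eq, map_one, one_mul, Finsupp.prod_fintype]
    · simp
    · simp
  rw [h, momentFunctional_monomial]
  simp

theorem momentFunctional_rename (g : ℕ → K) {N : ℕ} (σ : Equiv.Perm (Fin N))
    (P : MvPolynomial (Fin N) K) :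
    momentFunctional g N (MvPolynomial.rename σ P) = momentFunctional g N P := by
  have h : (momentFunctional g N).comp (MvPolynomial.rename (R := K) σ).toLinearMap =
      momentFunctional g N := by
    refine (MvPolynomial.basisMonomials (Fin N) K).ext fun m => ?_
    rw [MvPolynomial.coe_basisMonomials, LinearMap.comp_apply, AlgHom.toLinearMap_apply,
      MvPolynomial.rename_monomial, momentFunctional_monomial, momentFunctional_monomial,
      ← Equiv.prod_comp σ]
    refine Finset.prod_congr rfl fun i _ => ?_
    rw [Finsupp.mapDomain_apply σ.injective]
  exact LinearMap.congr_fun h P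

theorem rename_alternant {N : ℕ} (σ : Equiv.Perm (Fin N)) (b : Fin N → ℕ) :
    MvPolynomial.rename σ (alternant K b) =
      ((Equiv.Perm.sign σ : ℤ) : MvPolynomial (Fin N) K) * alternant K b := by
  rw [alternant, AlgHom.map_det, ← Matrix.det_permute']
  congr 1
  ext1 i k
  simp

theorem alternant_eq_sum {N : ℕ} (b : Fin N → ℕ) :
    alternant K b = ∑ σ : Equiv.Perm (Fin N),
      ((Equiv.Perm.sign σ : ℤ) : MvPolynomial (Fin N) K) *
        MvPolynomial.rename σ.symm (∏ k, MvPolynomial.X k ^ b k) := by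
  rw [alternant, Matrix.det_apply']
  refine Finset.sum_congr rfl fun σ _ => ?_
  congr 1
  rw [map_prod]
  conv_rhs => rw [← Equiv.prod_comp σ]
  simp

theorem map_intCast_mul (f : MvPolynomial (Fin N) K →ₗ[K] K) (z : ℤ)
    (P : MvPolynomial (Fin N) K) : f ((z : MvPolynomial (Fin N) K) * P) = (z : K) * f P := by
  rw [← zsmul_eq_mul, map_zsmul, zsmul_eq_mul]

theorem momentFunctional_alternant_mul (g : ℕ → K) {N : ℕ} (a b : Fin N → ℕ) :
    momentFunctional g N (alternant K a * ∏ k, MvPolynomial.X k ^ b k) =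
      (Matrix.of fun i k : Fin N => g (a i + b k)).det := by
  rw [alternant, Matrix.det_apply', Matrix.det_apply', Finset.sum_mul, map_sum]
  refine Finset.sum_congr rfl fun σ _ => ?_
  rw [mul_assoc, map_intCast_mul, ← Finset.prod_mul_distrib]
  congr 1
  simp only [Matrix.of_apply, ← pow_add]
  rw [momentFunctional_prod_X_pow]

/-- Expand the second alternant over permutations. The functional is invariant under permuting
variables and the first alternant changes by the sign, which cancels the sign of the expansion, so
all `N!` terms agree. -/
theorem momentFunctional_symmetric_mul (g : ℕ → K) {N : ℕ} {F : MvPolynomial (Fin N) K}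
    (hF : ∀ σ : Equiv.Perm (Fin N), MvPolynomial.rename σ F = F) (a b : Fin N → ℕ) :
    momentFunctional g N (F * alternant K a * alternant K b) = (N.factorial : K) *
      momentFunctional g N (F * alternant K a * ∏ k, MvPolynomial.X k ^ b k) := by
  rw [alternant_eq_sum b, Finset.mul_sum, map_sum]
  have h : ∀ σ : Equiv.Perm (Fin N), momentFunctional g N (F * alternant K a *
      (((Equiv.Perm.sign σ : ℤ) : MvPolynomial (Fin N) K) *
        MvPolynomial.rename σ.symm (∏ k, MvPolynomial.X k ^ b k))) =
      momentFunctional g N (F * alternant K a * ∏ k, MvPolynomial.X k ^ b k) := by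
    intro σ
    rw [← momentFunctional_rename g σ.symm (F * alternant K a * ∏ k, MvPolynomial.X k ^ b k)]
    rw [map_mul (MvPolynomial.rename _) (F * alternant K a),
      map_mul (MvPolynomial.rename _) F, hF, rename_alternant, Equiv.Perm.sign_symm]
    rw [mul_assoc, mul_assoc, mul_left_comm (alternant K a), mul_assoc]
  rw [Finset.sum_congr rfl fun σ _ => h σ, Finset.sum_const, Finset.card_univ,
    Fintype.card_perm, Fintype.card_fin, nsmul_eq_mul]

variable [CharZero K]

/-- Evaluation of symmetric functions (polynomials in the power sums) in `N` variables. -/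
def toSymmetric (K : Type*) [Field K] [CharZero K] (N : ℕ) :
    MvPolynomial ℕ ℚ →ₐ[ℚ] MvPolynomial (Fin N) K :=
  MvPolynomial.aeval fun n => ∑ i, MvPolynomial.X i ^ n

theorem rename_toSymmetric {N : ℕ} (σ : Equiv.Perm (Fin N)) (F : MvPolynomial ℕ ℚ) :
    MvPolynomial.rename σ (toSymmetric K N F) = toSymmetric K N F := by
  have h : ((MvPolynomial.rename (R := K) σ).restrictScalars ℚ).comp (toSymmetric K N) =
      toSymmetric K N := by
    ext1 n
    simp only [AlgHom.comp_apply, AlgHom.restrictScalars_apply, toSymmetric,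
      MvPolynomial.aeval_X, map_sum, map_pow, MvPolynomial.rename_X]
    exact Equiv.sum_comp σ fun i => (MvPolynomial.X i : MvPolynomial (Fin N) K) ^ n
  exact AlgHom.congr_fun h F

theorem toSymmetric_schurFunction_mul {N : ℕ} {lam : YoungDiagram} (hN : lam.colLen 0 ≤ N) :
    toSymmetric K N (schurFunction MvPolynomial.X lam) * alternant K (shiftedPart ⊥ N) =
      alternant K (shiftedPart lam N) := by
  have h1 := map_schurFunction (toSymmetric K N).toRingHom MvPolynomial.X lam
  have h2 := schurFunction_mul_alternant lam hN
    (MvPolynomial.X : Fin N → MvPolynomial (Fin N) K)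
  have h3 : alternant K (shiftedPart ⊥ N) = (Matrix.of fun i k : Fin N =>
      (MvPolynomial.X k : MvPolynomial (Fin N) K) ^ (N - 1 - (i : ℕ))).det := by
    simp only [alternant, shiftedPart_bot]
  rw [h3]
  refine Eq.trans ?_ h2
  congr 1
  refine h1.trans ?_
  congr 1
  ext1 n
  exact MvPolynomial.aeval_X _ n

/-- The functional `F ↦ L(F Δ x^δ)` on symmetric functions. -/
def symmetricMoment (g : ℕ → K) (N : ℕ) (F : MvPolynomial ℕ ℚ) : K :=
  momentFunctional g N (toSymmetric K N F * alternant K (shiftedPart ⊥ N) *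
    ∏ k, MvPolynomial.X k ^ shiftedPart ⊥ N k)

/-- The Andréief identity: up to `N!` both sides are the functional applied to the product of the
alternants of `lam` and `mu`. The factor `Δ` supplied by the definition turns one Schur function
into an alternant, and antisymmetrizing `x^δ` supplies the second `Δ`. -/
theorem symmetricMoment_schurFunction_mul (g : ℕ → K) {N : ℕ} {lam mu : YoungDiagram}
    (hlam : lam.colLen 0 ≤ N) (hmu : mu.colLen 0 ≤ N) :
    symmetricMoment g N (schurFunction MvPolynomial.X lam * schurFunction MvPolynomial.X mu) =
      (Matrix.of fun i k : Fin N => g (shiftedPart lam N i + shiftedPart mu N k)).det := by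
  have hN : (N.factorial : K) ≠ 0 := Nat.cast_ne_zero.mpr N.factorial_ne_zero
  refine mul_left_cancel₀ hN ?_
  rw [symmetricMoment, ← momentFunctional_symmetric_mul g (fun σ => rename_toSymmetric σ _),
    ← momentFunctional_alternant_mul, ← one_mul (alternant K (shiftedPart lam N)),
    ← momentFunctional_symmetric_mul g (fun σ => map_one _), one_mul,
    ← toSymmetric_schurFunction_mul hlam, ← toSymmetric_schurFunction_mul hmu,
    map_mul (toSymmetric K N)]
  congr 1
  ring

end MomentFunctional

/-! ### Gaussian moments and the general case -/

section GaussianMoments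

variable {K : Type*} [Field K] {q r : K}

/-- The moments `(-1)^m q^{m²/2 - (N - 1) m}`, where `r = q^{1/2}`. -/
def gaussianMoment (q r : K) (N m : ℕ) : K := (-1) ^ m * r ^ m ^ 2 / q ^ ((N - 1) * m)

/-- The exponent is quadratic with cross term `ab`; hence the moment determinant is `powDet` up to
row and column factors. -/
theorem gaussianMoment_add (hr : r ^ 2 = q) (N a b : ℕ) :
    gaussianMoment q r N (a + b) =
      gaussianMoment q r N a * gaussianMoment q r N b * q ^ (a * b) := by
  have h : r ^ (a + b) ^ 2 = r ^ a ^ 2 * r ^ b ^ 2 * q ^ (a * b) := by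
    rw [← hr, ← pow_mul, ← pow_add, ← pow_add]
    congr 1
    ring
  rw [gaussianMoment, gaussianMoment, gaussianMoment, h, mul_add, pow_add, pow_add,
    div_mul_div_comm, div_mul_eq_mul_div]
  congr 1
  ring

theorem gaussianMoment_ne_zero (hr : r ^ 2 = q) (hq0 : q ≠ 0) (N m : ℕ) :
    gaussianMoment q r N m ≠ 0 :=
  div_ne_zero (mul_ne_zero (pow_ne_zero _ (neg_ne_zero.mpr one_ne_zero))
    (pow_ne_zero _ (ne_zero_of_sq_eq hr hq0))) (pow_ne_zero _ hq0)

theorem gaussianMoment_add_row (hr : r ^ 2 = q) (hq0 : q ≠ 0) {N i : ℕ} (hi : i < N) (m : ℕ) :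
    gaussianMoment q r N (m + (N - 1 - i)) =
      (∏ j ∈ Finset.range m, (-(q ^ j / q ^ i) * r)) * gaussianMoment q r N (N - 1 - i) := by
  induction m with
  | zero => simp
  | succ m ih =>
    rw [Finset.prod_range_succ, mul_right_comm, ← ih, add_right_comm, gaussianMoment_add hr,
      mul_assoc]
    congr 1
    have h1 : gaussianMoment q r N 1 = -r / q ^ (N - 1) := by
      simp [gaussianMoment]
    have h2 : q ^ (N - 1) = q ^ (N - 1 - i) * q ^ i := by
      rw [← pow_add]
      congr 1
      omega
    have h3 : q ^ (N - 1 - i) ≠ 0 := pow_ne_zero _ hq0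
    have h4 : q ^ i ≠ 0 := pow_ne_zero _ hq0
    rw [h1, h2, mul_one, pow_add]
    field_simp

/-- The linear term `-(N - 1) m` of the exponent is chosen for this: raising the shifted part by one
across the cell `(i, j)` multiplies the moment by `-q^{j-i} r`, so the row factors are exactly
framing factors and powers of `r`. -/
theorem prod_gaussianMoment (hr : r ^ 2 = q) (hq0 : q ≠ 0) {lam : YoungDiagram} {N : ℕ}
    (hN : lam.colLen 0 ≤ N) :
    ∏ i, gaussianMoment q r N (shiftedPart lam N i) =
      framingFactor q lam * r ^ lam.card * ∏ i, gaussianMoment q r N (shiftedPart ⊥ N i) := by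
  have h1 : framingFactor q lam * r ^ lam.card =
      ∏ c ∈ lam.cells, (-(q ^ c.2 / q ^ c.1) * r) := by
    rw [framingFactor_eq hq0, Finset.prod_mul_distrib, Finset.prod_const]
  rw [h1, YoungDiagram.prod_cells hN fun i j => -(q ^ j / q ^ i) * r, Finset.prod_range,
    ← Finset.prod_mul_distrib]
  refine Finset.prod_congr rfl fun i _ => ?_
  rw [shiftedPart_bot, shiftedPart, gaussianMoment_add_row hr hq0 i.2]

/-- The normalization of the Gaussian functional. -/
def gaussianNorm (q r : K) (N : ℕ) : K :=
  (∏ i, gaussianMoment q r N (shiftedPart ⊥ N i)) ^ 2 *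
    powDet q (shiftedPart ⊥ N) (shiftedPart ⊥ N)

theorem gaussianNorm_ne_zero (hr : r ^ 2 = q) (hq0 : q ≠ 0) (hq : ∀ n : ℕ, 1 ≤ n → q ^ n ≠ 1)
    (N : ℕ) : gaussianNorm q r N ≠ 0 :=
  mul_ne_zero (pow_ne_zero _ (Finset.prod_ne_zero_iff.mpr fun _ _ =>
    gaussianMoment_ne_zero hr hq0 _ _))
    (powDet_shiftedPart_bot_ne_zero hq0 hq (shiftedPart_strictAnti ⊥ N).injective)

variable [CharZero K]

/-- The right hand side of the theorem. -/
def gikvPolynomial (q r : K) (lam mu : YoungDiagram) : K[X] :=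
  C (framingFactor q lam) * C (framingFactor q mu) *
    schurFunction (powerSumMixed q r ⊥) lam * schurFunction (powerSumMixed q r lam) mu

theorem symmetricMoment_gaussianMoment (hr : r ^ 2 = q) (hq0 : q ≠ 0)
    (hq : ∀ n : ℕ, 1 ≤ n → q ^ n ≠ 1) {lam mu : YoungDiagram} {N : ℕ}
    (hlam : lam.colLen 0 ≤ N) (hmu : mu.colLen 0 ≤ N) :
    symmetricMoment (gaussianMoment q r N) N
        (schurFunction MvPolynomial.X lam * schurFunction MvPolynomial.X mu) =
      gaussianNorm q r N * (gikvPolynomial q r lam mu).eval (q ^ N) := by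
  have h1 : (Matrix.of fun i k : Fin N =>
      gaussianMoment q r N (shiftedPart lam N i + shiftedPart mu N k)).det =
      (∏ i, gaussianMoment q r N (shiftedPart lam N i)) *
        ((∏ i, gaussianMoment q r N (shiftedPart mu N i)) *
          powDet q (shiftedPart lam N) (shiftedPart mu N)) := by
    rw [powDet, ← Matrix.det_mul_row, ← Matrix.det_mul_column]
    congr 1
    ext i k
    simp only [Matrix.of_apply]
    rw [gaussianMoment_add hr, mul_assoc]
  rw [symmetricMoment_schurFunction_mul _ hlam hmu, h1, prod_gaussianMoment hr hq0 hlam,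
    prod_gaussianMoment hr hq0 hmu, gaussianNorm, gikvPolynomial]
  have h2 := eval_schurFunction_powerSumMixed_mul hr hq0 hq hlam hmu
  simp only [eval_mul, eval_C]
  rw [pow_add] at h2
  linear_combination (-(∏ i, gaussianMoment q r N (shiftedPart ⊥ N i)) ^ 2 *
    framingFactor q lam * framingFactor q mu) * h2

theorem gikvPolynomial_bot_right (q r : K) (lam : YoungDiagram) :
    gikvPolynomial q r lam ⊥ =
      C (framingFactor q lam) * schurFunction (powerSumMixed q r ⊥) lam := by
  have h : framingFactor q ⊥ = 1 := by simp [framingFactor]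
  rw [gikvPolynomial, schurFunction_bot, h, map_one, mul_one, mul_one]

/-- The generating series of the values of a symmetric function at the `q^eta q^ρ`. -/
def gikvSeries (q r : K) (F : MvPolynomial ℕ ℚ) : PowerSeries K :=
  PowerSeries.mk fun k => ∑ eta ∈ (finite_setOf_card_eq k).toFinset,
    MvPolynomial.aeval (powerSumRho q r eta) F * gikvWeight q (r ^ 2) eta

theorem gikvSeries_schurFunction_mul (q r : K) (lam mu : YoungDiagram) :
    gikvSeries q r (schurFunction MvPolynomial.X lam * schurFunction MvPolynomial.X mu) =
      gikvZ q r lam mu := by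
  have h : ∀ (p : ℕ → K) (nu : YoungDiagram),
      MvPolynomial.aeval p (schurFunction (MvPolynomial.X : ℕ → MvPolynomial ℕ ℚ) nu) =
        schurFunction p nu := by
    intro p nu
    refine (map_schurFunction (MvPolynomial.aeval (R := ℚ) p).toRingHom MvPolynomial.X nu).trans ?_
    congr 1
    ext1 n
    exact MvPolynomial.aeval_X _ n
  simp only [gikvSeries, gikvZ, map_mul, h]

/-- Two linear objects are compared on the span of the Schur functions: the series of `F` and the
Gaussian functional of `F` for all large `N`. A single polynomial `P`, independent of `N`, describes
both for each `s_nu`, hence for every `F` in the span. For `F = s_lam s_mu` the functional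
identifies `P`. -/
theorem gikvZ_eq_mul (hr : r ^ 2 = q) (hq0 : q ≠ 0) (hq : ∀ n : ℕ, 1 ≤ n → q ^ n ≠ 1)
    (lam mu : YoungDiagram) :
    gikvZ q r lam mu = gikvZ q r ⊥ ⊥ * (gikvPolynomial q r lam mu : PowerSeries K) := by
  have key : ∀ F ∈ Submodule.span ℚ
      (Set.range (schurFunction (MvPolynomial.X : ℕ → MvPolynomial ℕ ℚ))),
      ∃ P : K[X], gikvSeries q r F = gikvZ q r ⊥ ⊥ * (P : PowerSeries K) ∧
        ∃ N₀ : ℕ, ∀ N, N₀ ≤ N → symmetricMoment (gaussianMoment q r N) N F =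
          gaussianNorm q r N * P.eval (q ^ N) := by
    intro F hF
    induction hF using Submodule.span_induction with
    | mem F hF =>
      obtain ⟨nu, rfl⟩ := hF
      refine ⟨gikvPolynomial q r nu ⊥, ?_, nu.colLen 0, fun N hN => ?_⟩
      · rw [gikvPolynomial_bot_right, ← gikvZ_bot_right_eq_mul hr hq0 hq,
          ← gikvSeries_schurFunction_mul, schurFunction_bot, mul_one]
      · rw [← symmetricMoment_gaussianMoment hr hq0 hq hN
          (by rw [YoungDiagram.colLen_bot]; exact Nat.zero_le _), schurFunction_bot, mul_one]
    | zero =>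
      refine ⟨0, ?_, 0, fun N _ => ?_⟩
      · ext k
        simp [gikvSeries]
      · simp [symmetricMoment]
    | add F G _ _ hF hG =>
      obtain ⟨P, hP, N₁, h₁⟩ := hF
      obtain ⟨R, hR, N₂, h₂⟩ := hG
      refine ⟨P + R, ?_, max N₁ N₂, fun N hN => ?_⟩
      · rw [Polynomial.coe_add, mul_add, ← hP, ← hR]
        ext k
        simp [gikvSeries, add_mul, Finset.sum_add_distrib]
      · rw [eval_add, mul_add, ← h₁ N ((le_max_left _ _).trans hN),
          ← h₂ N ((le_max_right _ _).trans hN)]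
        simp [symmetricMoment, add_mul]
    | smul a F _ hF =>
      obtain ⟨P, hP, N₁, h₁⟩ := hF
      refine ⟨C (a : K) * P, ?_, N₁, fun N hN => ?_⟩
      · rw [Polynomial.coe_mul, Polynomial.coe_C, mul_left_comm, ← hP]
        ext k
        simp only [gikvSeries, PowerSeries.coeff_C_mul, PowerSeries.coeff_mk, map_smul,
          Finset.mul_sum, Rat.smul_def, mul_assoc]
      · rw [eval_mul, eval_C, mul_left_comm, ← h₁ N hN, symmetricMoment, symmetricMoment,
          map_smul, smul_mul_assoc, smul_mul_assoc, map_rat_smul, Rat.smul_def]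
  obtain ⟨P, hP, N₀, hN₀⟩ := key _ (schurFunction_mul_mem_span MvPolynomial.X lam mu)
  rw [gikvSeries_schurFunction_mul] at hP
  have h : P = gikvPolynomial q r lam mu := by
    apply polynomial_eq_of_eval_pow_eq hq0 hq (max N₀ (max (lam.colLen 0) (mu.colLen 0)))
    intro N hN
    have h1 := hN₀ N ((le_max_left _ _).trans hN)
    have h2 := (le_max_right _ _).trans hN
    rw [symmetricMoment_gaussianMoment hr hq0 hq ((le_max_left _ _).trans h2)
      ((le_max_right _ _).trans h2)] at h1
    exact (mul_left_cancel₀ (gaussianNorm_ne_zero hr hq0 hq N) h1).symm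
  rw [hP, h]

end GaussianMoments

/-! ### Nonvanishing of the top coefficient for transcendental `q` -/

section Nonvanishing

/-- The degree at infinity of `x` is at most `n`. -/
def DegreeLE (x : RatFunc ℚ) (n : ℤ) : Prop := x = 0 ∨ x.intDegree ≤ n

theorem DegreeLE.add {x y : RatFunc ℚ} {n : ℤ} (hx : DegreeLE x n) (hy : DegreeLE y n) :
    DegreeLE (x + y) n := by
  rcases hx with rfl | hx
  · rwa [zero_add]
  rcases eq_or_ne y 0 with rfl | hy0
  · rw [add_zero]
    exact Or.inr hx
  have hy := hy.resolve_left hy0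
  by_cases hxy : x + y = 0
  · exact Or.inl hxy
  · exact Or.inr ((RatFunc.intDegree_add_le hy0 hxy).trans (max_le hx hy))

theorem DegreeLE.sum {ι : Type*} {s : Finset ι} {x : ι → RatFunc ℚ} {n : ℤ}
    (h : ∀ i ∈ s, DegreeLE (x i) n) : DegreeLE (∑ i ∈ s, x i) n :=
  Finset.sum_induction _ (fun y => DegreeLE y n) (fun _ _ => DegreeLE.add) (Or.inl rfl) h

theorem DegreeLE.mul {x y : RatFunc ℚ} {m n : ℤ} (hx : DegreeLE x m) (hy : DegreeLE y n) :
    DegreeLE (x * y) (m + n) := by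
  by_cases hx0 : x = 0
  · exact Or.inl (by rw [hx0, zero_mul])
  by_cases hy0 : y = 0
  · exact Or.inl (by rw [hy0, mul_zero])
  · refine Or.inr ?_
    rw [RatFunc.intDegree_mul hx0 hy0]
    exact add_le_add (hx.resolve_left hx0) (hy.resolve_left hy0)

theorem intDegree_X_pow (n : ℕ) : (RatFunc.X ^ n : RatFunc ℚ).intDegree = n := by
  rw [← RatFunc.algebraMap_X, ← map_pow, RatFunc.intDegree_polynomial, natDegree_X_pow]

/-- By the strict rearrangement inequality the identity permutation alone attains the largest
exponent. -/
theorem hasTopCoeff_powDet {N : ℕ} {e f : Fin N → ℕ} (he : StrictAnti e) (hf : StrictAnti f) :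
    HasTopCoeff (powDet (X ^ 2 : ℚ[X]) e f) (2 * ∑ i, e i * f i) 1 := by
  have h1 : (1 : ℚ) = ∑ σ : Equiv.Perm (Fin N),
      ((Equiv.Perm.sign σ : ℤ) : ℚ) * if σ = 1 then 1 else 0 := by
    simp
  rw [powDet, Matrix.det_apply', h1]
  apply HasTopCoeff.sum
  intro σ _
  apply HasTopCoeff.intCast_mul
  simp only [Matrix.of_apply]
  rw [Finset.prod_pow_eq_pow_sum, ← pow_mul]
  by_cases hσ : σ = 1
  · rw [if_pos hσ, hσ]
    simp only [Equiv.Perm.coe_one, id_eq]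
    exact ⟨by simp, by simp⟩
  · have h2 : ∑ i, e (σ i) * f i < ∑ i, e i * f i := by
      rw [(he.antitone.monovary hf.antitone).sum_comp_perm_mul_lt_sum_mul_iff]
      intro h
      apply hσ
      rw [← Equiv.Perm.monotone_iff]
      intro i j hij
      rcases hij.eq_or_lt with rfl | hij
      · exact le_rfl
      · exact he.le_iff_ge.mp (h (hf hij))
    rw [if_neg hσ]
    refine ⟨?_, ?_⟩
    · rw [natDegree_X_pow]
      omega
    · rw [coeff_X_pow, if_neg (by omega)]

theorem powDet_X_ne_zero {N : ℕ} {e f : Fin N → ℕ} (he : StrictAnti e) (hf : StrictAnti f) :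
    powDet (X ^ 2 : ℚ[X]) e f ≠ 0 := by
  intro h
  have h1 := (hasTopCoeff_powDet he hf).2
  rw [h, coeff_zero] at h1
  exact zero_ne_one h1

theorem natDegree_powDet_X {N : ℕ} {e f : Fin N → ℕ} (he : StrictAnti e) (hf : StrictAnti f) :
    (powDet (X ^ 2 : ℚ[X]) e f).natDegree = 2 * ∑ i, e i * f i := by
  have h1 := hasTopCoeff_powDet he hf
  exact le_antisymm h1.1 (le_natDegree_of_ne_zero (by rw [h1.2]; exact one_ne_zero))

theorem algebraMap_powDet {N : ℕ} (e f : Fin N → ℕ) :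
    algebraMap ℚ[X] (RatFunc ℚ) (powDet (X ^ 2) e f) = powDet (RatFunc.X ^ 2) e f := by
  rw [powDet, RingHom.map_det, powDet]
  congr 1
  ext i k
  simp

theorem ratFunc_X_sq_pow_ne_one (n : ℕ) (hn : 1 ≤ n) : (RatFunc.X ^ 2 : RatFunc ℚ) ^ n ≠ 1 := by
  intro h
  have h1 := congrArg RatFunc.intDegree h
  rw [← pow_mul, intDegree_X_pow, RatFunc.intDegree_one] at h1
  omega

/-- This is the coefficient of `Q^d`, `d = |mu|`, in `s_mu(Q q^lam q^ρ, q^{-ρ})`. If it were zero,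
the value at `Q = X^{2N}` would have degree at most `2N(d - 1)` plus a constant, while the quotient
of alternants has degree at least `d + 2d(N - d)`. -/
theorem schurFunction_powerSumRho_ratFunc_ne_zero (lam mu : YoungDiagram) :
    schurFunction (powerSumRho (RatFunc.X ^ 2 : RatFunc ℚ) RatFunc.X lam) mu ≠ 0 := by
  intro h0
  have hX : (RatFunc.X ^ 2 : RatFunc ℚ) ≠ 0 := pow_ne_zero _ RatFunc.X_ne_zero
  set G := schurFunction (powerSumMixed (RatFunc.X ^ 2 : RatFunc ℚ) RatFunc.X lam) mu with hG
  set d := mu.card with hd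
  have htop := hasTopCoeff_schurFunction_powerSumMixed (RatFunc.X ^ 2 : RatFunc ℚ) RatFunc.X lam mu
  rw [h0, ← hG, ← hd] at htop
  obtain ⟨B, hB⟩ : ∃ B : ℕ, ∀ k ∈ Finset.range d, (G.coeff k).intDegree ≤ B := by
    refine ⟨(Finset.range d).sup fun k => (G.coeff k).intDegree.toNat, fun k hk => ?_⟩
    have h1 := Finset.le_sup (f := fun k => (G.coeff k).intDegree.toNat) hk
    exact (Int.self_le_toNat _).trans (by exact_mod_cast h1)
  -- The two degree bounds together force `2N ≤ B + 2d²`, which this `N` violates; the other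
  -- summands make `N` at least both lengths and `d`. The bound `B` depends only on the
  -- coefficients, not on `N`.
  set N : ℕ := B + 2 * d ^ 2 + lam.colLen 0 + mu.colLen 0 + d + 1 with hN
  have heval := eval_schurFunction_powerSumMixed rfl hX ratFunc_X_sq_pow_ne_one
    (show lam.colLen 0 ≤ N by omega) (show mu.colLen 0 ≤ N by omega)
  rw [← hG, ← hd, ← algebraMap_powDet, ← algebraMap_powDet] at heval
  have hlamA := shiftedPart_strictAnti lam N
  have hmuA := shiftedPart_strictAnti mu N
  have hbotA := shiftedPart_strictAnti ⊥ N
  have hinj := IsFractionRing.injective ℚ[X] (RatFunc ℚ)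
  have hD1 : algebraMap ℚ[X] (RatFunc ℚ)
      (powDet (X ^ 2) (shiftedPart ⊥ N) (shiftedPart lam N)) ≠ 0 :=
    (map_ne_zero_iff _ hinj).mpr (powDet_X_ne_zero hbotA hlamA)
  have hD2 : algebraMap ℚ[X] (RatFunc ℚ)
      (powDet (X ^ 2) (shiftedPart mu N) (shiftedPart lam N)) ≠ 0 :=
    (map_ne_zero_iff _ hinj).mpr (powDet_X_ne_zero hmuA hlamA)
  have hXd : (RatFunc.X ^ d : RatFunc ℚ) ≠ 0 := pow_ne_zero _ RatFunc.X_ne_zero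
  have hG0 : G.eval ((RatFunc.X ^ 2) ^ N) ≠ 0 :=
    left_ne_zero_of_mul (heval.trans_ne (mul_ne_zero hXd hD2))
  have hdeg := congrArg RatFunc.intDegree heval
  rw [RatFunc.intDegree_mul hG0 hD1, RatFunc.intDegree_mul hXd hD2,
    RatFunc.intDegree_polynomial, RatFunc.intDegree_polynomial, natDegree_powDet_X hbotA hlamA,
    natDegree_powDet_X hmuA hlamA, intDegree_X_pow] at hdeg
  have hsplit : ∑ i, shiftedPart mu N i * shiftedPart lam N i =
      ∑ i : Fin N, mu.rowLen i * shiftedPart lam N i +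
        ∑ i, shiftedPart ⊥ N i * shiftedPart lam N i := by
    rw [← Finset.sum_add_distrib]
    refine Finset.sum_congr rfl fun i _ => ?_
    rw [shiftedPart_eq_add mu, add_mul]
  have hlow : d * (N - d) ≤ ∑ i : Fin N, mu.rowLen i * shiftedPart lam N i := by
    rw [hd, YoungDiagram.card_eq_sum_rowLen (show mu.colLen 0 ≤ N by omega), Finset.sum_mul,
      ← YoungDiagram.card_eq_sum_rowLen (show mu.colLen 0 ≤ N by omega)]
    refine Finset.sum_le_sum fun i _ => ?_
    rcases Nat.eq_zero_or_pos (mu.rowLen i) with h1 | h1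
    · rw [h1, zero_mul, zero_mul]
    -- A nonzero part `mu_i` has `i < ℓ(mu) ≤ d`, so the shifted part of `lam` there is at least `N
    -- - 1 - i ≥ N - d`.
    · apply Nat.mul_le_mul_left
      have h2 := YoungDiagram.mem_iff_lt_colLen.mp (YoungDiagram.mem_iff_lt_rowLen.mpr h1)
      have h3 := mu.colLen_zero_le_card
      rw [shiftedPart]
      omega
  have hup : DegreeLE (G.eval ((RatFunc.X ^ 2) ^ N)) (B + 2 * N * ((d : ℤ) - 1)) := by
    have h1 : G.eval ((RatFunc.X ^ 2) ^ N) =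
        ∑ k ∈ Finset.range d, G.coeff k * ((RatFunc.X ^ 2) ^ N) ^ k := by
      rw [eval_eq_sum_range' (n := d + 1) (by have := htop.1; omega), Finset.sum_range_succ,
        htop.2, zero_mul, add_zero]
    rw [h1]
    apply DegreeLE.sum
    intro k hk
    refine DegreeLE.mul (Or.inr (hB k hk)) (Or.inr ?_)
    rw [← pow_mul, ← pow_mul, intDegree_X_pow]
    rw [Finset.mem_range] at hk
    push_cast
    rw [← mul_assoc]
    exact mul_le_mul_of_nonneg_left (by omega) (by positivity)
  have hup := hup.resolve_left hG0
  have hNd : ((N - d : ℕ) : ℤ) = (N : ℤ) - d := by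
    rw [Nat.cast_sub]
    omega
  have hlow' : (d : ℤ) * ((N : ℤ) - d) ≤
      ((∑ i : Fin N, mu.rowLen i * shiftedPart lam N i : ℕ) : ℤ) := by
    rw [← hNd]
    exact_mod_cast hlow
  rw [hsplit] at hdeg
  push_cast at hdeg hlow'
  have hN' : (N : ℤ) = B + 2 * (d : ℤ) ^ 2 + lam.colLen 0 + mu.colLen 0 + d + 1 := by
    rw [hN]
    push_cast
    rfl
  have h2 : (2 : ℤ) * N ≤ B + 2 * (d : ℤ) ^ 2 := by
    linarith [Int.natCast_nonneg d]
  have h3 : (0 : ℤ) ≤ (d : ℤ) ^ 2 := by positivity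
  linarith [Int.natCast_nonneg d, Int.natCast_nonneg B, Int.natCast_nonneg (lam.colLen 0),
    Int.natCast_nonneg (mu.colLen 0)]

/-- The square root `r` is transcendental as well, so `X ↦ r` embeds the rational function field in
`K` and carries the generic value to this one. -/
theorem schurFunction_powerSumRho_ne_zero {K : Type*} [Field K] [CharZero K] {q r : K}
    (hr : r ^ 2 = q) (hq : Transcendental ℚ q) (lam mu : YoungDiagram) :
    schurFunction (powerSumRho q r lam) mu ≠ 0 := by
  have hrt : Transcendental ℚ r := by
    intro h
    apply hq
    rw [← hr]
    exact h.pow 2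
  have hinj : Function.Injective (aeval (R := ℚ) r).toRingHom :=
    transcendental_iff_injective.mp hrt
  set φ : RatFunc ℚ →+* K := IsFractionRing.lift hinj with hφ
  have hφX : φ RatFunc.X = r := by
    rw [← RatFunc.algebraMap_X, hφ, IsFractionRing.lift_algebraMap]
    exact aeval_X r
  have h1 := map_schurFunction φ (powerSumRho (RatFunc.X ^ 2 : RatFunc ℚ) RatFunc.X lam) mu
  have h2 : (fun n => φ (powerSumRho (RatFunc.X ^ 2 : RatFunc ℚ) RatFunc.X lam n)) =
      powerSumRho q r lam := by
    ext n
    simp [powerSumRho, hφX, hr]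
  rw [h2] at h1
  rw [← h1]
  exact (map_ne_zero φ).mpr (schurFunction_powerSumRho_ratFunc_ne_zero lam mu)

end Nonvanishing

end

/-! ### The quotient formula and the degree -/

theorem proposition4p3 {K : Type*} [Field K] [CharZero K] (q r : K) (hr : r ^ 2 = q)
    (hq0 : q ≠ 0) (hq : ∀ n : ℕ, 1 ≤ n → q ^ n ≠ 1) (lam mu : YoungDiagram) :
    PowerSeries.constantCoeff (gikvZ q r ⊥ ⊥) = 1 ∧
    ∃ P : Polynomial K,
      P = Polynomial.C (framingFactor q lam) * Polynomial.C (framingFactor q mu) *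
            schurFunction (powerSumMixed q r ⊥) lam * schurFunction (powerSumMixed q r lam) mu ∧
      gikvZ q r lam mu * (gikvZ q r ⊥ ⊥)⁻¹ = (P : PowerSeries K) ∧
      P.natDegree ≤ lam.card + mu.card ∧
      (Transcendental ℚ q → P.degree = ((lam.card + mu.card : ℕ) : WithBot ℕ)) := by
  have hZ := constantCoeff_gikvZ_bot q r
  have htop : HasTopCoeff (gikvPolynomial q r lam mu) (lam.card + mu.card)
      (framingFactor q lam * framingFactor q mu * schurFunction (powerSumRho q r ⊥) lam *
        schurFunction (powerSumRho q r lam) mu) := by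
    have h1 : HasTopCoeff
        (Polynomial.C (framingFactor q lam) * Polynomial.C (framingFactor q mu)) 0
        (framingFactor q lam * framingFactor q mu) := by
      rw [← Polynomial.C_mul]
      exact ⟨(Polynomial.natDegree_C _).le, Polynomial.coeff_C_zero⟩
    have h2 := (h1.mul (hasTopCoeff_schurFunction_powerSumMixed q r ⊥ lam)).mul
      (hasTopCoeff_schurFunction_powerSumMixed q r lam mu)
    rwa [zero_add] at h2
  refine ⟨hZ, gikvPolynomial q r lam mu, rfl, ?_, htop.1, fun hqt => ?_⟩
  · rw [gikvZ_eq_mul hr hq0 hq, mul_right_comm, PowerSeries.mul_inv_cancel, one_mul]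
    rw [hZ]
    exact one_ne_zero
  · have hf : ∀ nu, framingFactor q nu ≠ 0 := by
      intro nu
      rw [framingFactor_eq hq0]
      exact Finset.prod_ne_zero_iff.mpr fun c _ =>
        neg_ne_zero.mpr (div_ne_zero (pow_ne_zero _ hq0) (pow_ne_zero _ hq0))
    have hne : (gikvPolynomial q r lam mu).coeff (lam.card + mu.card) ≠ 0 := by
      rw [htop.2]
      exact mul_ne_zero (mul_ne_zero (mul_ne_zero (hf lam) (hf mu))
        (schurFunction_powerSumRho_bot_ne_zero hr hq0 hq lam))
        (schurFunction_powerSumRho_ne_zero hr hqt lam mu)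
    rw [Polynomial.degree_eq_natDegree (fun h => hne (by rw [h, Polynomial.coeff_zero]))]
    exact congrArg _ (le_antisymm htop.1 (Polynomial.le_natDegree_of_ne_zero hne))
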